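/- A pair $\{p,q\}$ of distinct odd primes is called a symmetric pair if $\gcd(p-1,q-1)=|p-q|$, and a prime is called symmetric if it belongs to some symmetric pair. Let $S(x)$ be the number of symmetric primes $p\le x$, let $\pi(x)$ be the number of primes $p\le x$, and let $\eta=1-\frac{1+\log\log 2}{\log 2}=0.08607\ldots$. Then there is an absolute constant $C$ such that, for all sufficiently large real $x$, $$S(x)\le\frac{\pi(x)}{(\log x)^{\eta}}(\log\log x)^{C}.$$ -/

import Mathlib

/-- `{p, q}` is a symmetric pair: `p` and `q` are distinct odd primes with
`gcd (p - 1, q - 1) = |p - q|`. -/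
def IsSymmetricPair (p q : ℕ) : Prop :=
  p.Prime ∧ q.Prime ∧ Odd p ∧ Odd q ∧ p ≠ q ∧
    (Nat.gcd (p - 1) (q - 1) : ℤ) = |(p : ℤ) - (q : ℤ)|

/-- A prime is symmetric if it belongs to some symmetric pair. -/
def IsSymmetricPrime (p : ℕ) : Prop :=
  ∃ q : ℕ, IsSymmetricPair p q

/-- `S(x)`: the number of symmetric primes `p ≤ x`. -/
noncomputable def symmetricPrimeCount (x : ℝ) : ℕ :=
  Set.ncard {p : ℕ | (p : ℝ) ≤ x ∧ IsSymmetricPrime p}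

/-- The constant `η = 1 - (1 + log log 2) / log 2 = 0.08607…`. -/
noncomputable def symmetricEta : ℝ :=
  1 - (1 + Real.log (Real.log 2)) / Real.log 2

/-!
If `{p, q}` is a symmetric pair with `|p - q| = d`, then `p = a d + 1` and `q = (a ± 1) d + 1`, so
the symmetric primes `p` come with a factorization `p - 1 = a d` for which `(a ± 1) d + 1` is prime
as well. Put `κ = 1 / log 2` and let `Ω` count prime factors with multiplicity.

* Few primes `p ≤ x` have `Ω(p - 1) ≥ κ log log x`. Writing `p - 1 = m P` with `P` a large prime,
  the sieve bounds the number of `P` for given `m`, and weighting by `κ ^ Ω(m)` (Rankin's trick) gives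
  `x (log x) ^ (κ - 2 - κ log κ)`, up to powers of `log log x`.
* If `Ω(p - 1) < κ log log x`, the large prime `P` divides `a` or `d`. For a fixed choice of the
  cofactors, `P`, `p` and `q` are three linear forms in `P` which are simultaneously prime. The
  sieve saves `(log x) ^ 3`, and weighting by `(κ / 2) ^ Ω` over the two cofactors costs
  `(log x) ^ κ`. The result is `x (log x) ^ (κ - 3 - κ log (κ / 2))`.

Both powers of `log x` equal `(log x) ^ (-1 - η)`; this is what the choice of `κ` achieves. The `p`
for which `p - 1` has no prime factor above `smoothCutoff x = x ^ (1 / (13 log log x))` are negligible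
by Rankin's bound `exists_card_smoothNumbers_le`.

Since powers of `log log x` are allowed, Brun's pure sieve (`card_sifted_le`), with sieving level
`x ^ (1 / (338 (log log x) ^ 2))`, is strong enough. With Mertens' second theorem it yields
`exists_card_prime_values_le`, which is uniform in the coefficients of the linear forms. The two
cases are `exists_card_primes_many_factors_le` and `exists_card_prime_pairs_few_factors_le`.
-/

/-! ### Completely multiplicative functions and Mertens' theorems -/

open ArithmeticFunction in
/-- The completely multiplicative function `m ↦ w ^ Ω(m) * m ^ (-σ)`, with value `0` at `0`. -/
noncomputable def omegaTwist (w σ : ℝ) : ℕ →* ℝ where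
  toFun m := if m = 0 then 0 else w ^ cardFactors m * (m : ℝ) ^ (-σ)
  map_one' := by simp
  map_mul' m n := by
    by_cases hm : m = 0
    · simp [hm]
    by_cases hn : n = 0
    · simp [hn]
    rw [if_neg hm, if_neg hn, if_neg (mul_ne_zero hm hn), cardFactors_mul hm hn, pow_add,
      Nat.cast_mul, Real.mul_rpow (by positivity) (by positivity)]
    ring

open ArithmeticFunction in
theorem omegaTwist_of_ne_zero (w σ : ℝ) {m : ℕ} (hm : m ≠ 0) :
    omegaTwist w σ m = w ^ cardFactors m * (m : ℝ) ^ (-σ) := by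
  simp [omegaTwist, hm]

theorem omegaTwist_prime (w σ : ℝ) {p : ℕ} (hp : p.Prime) :
    omegaTwist w σ p = w * (p : ℝ) ^ (-σ) := by
  rw [omegaTwist_of_ne_zero w σ hp.ne_zero, ArithmeticFunction.cardFactors_apply_prime hp, pow_one]

theorem omegaTwist_nonneg {w : ℝ} (hw : 0 ≤ w) (σ : ℝ) (m : ℕ) : 0 ≤ omegaTwist w σ m := by
  by_cases hm : m = 0
  · simp [omegaTwist, hm]
  · rw [omegaTwist_of_ne_zero w σ hm]; positivity

/-- A sum of a nonnegative completely multiplicative function over smooth numbers is at most the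
corresponding Euler product. -/
theorem sum_le_prod_primesBelow {f : ℕ →* ℝ} (h0 : ∀ m, 0 ≤ f m)
    (h1 : ∀ p : ℕ, p.Prime → f p < 1) (N : ℕ) (s : Finset ℕ) (hs : ∀ m ∈ s, m ∈ N.smoothNumbers) :
    ∑ m ∈ s, f m ≤ ∏ p ∈ N.primesBelow, (1 - f p)⁻¹ := by
  have hn : ∀ {p : ℕ}, p.Prime → ‖f p‖ < 1 := fun {p} hp => by
    rw [Real.norm_of_nonneg (h0 p)]; exact h1 p hp
  have H := (EulerProduct.summable_and_hasSum_smoothNumbers_prod_primesBelow_geometric hn N).2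
  rw [← Finset.sum_subtype_of_mem (fun m => f m) hs]
  exact sum_le_hasSum _ (fun i _ => h0 i) H

theorem inv_one_sub_le_exp {t : ℝ} (ht : t < 1) : (1 - t)⁻¹ ≤ Real.exp (t + t ^ 2 / (1 - t)) := by
  have h : 0 < 1 - t := by linarith
  have e : (1 - t)⁻¹ = t + t ^ 2 / (1 - t) + 1 := by field_simp; ring
  rw [e]; exact Real.add_one_le_exp _

theorem exp_le_inv_one_sub {t : ℝ} (ht : t < 1) : Real.exp t ≤ (1 - t)⁻¹ := by
  have h : 0 < 1 - t := by linarith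
  rw [← inv_inv (Real.exp t), ← Real.exp_neg]
  exact inv_anti₀ h (by linarith [Real.add_one_le_exp (-t)])

theorem sum_primesLE_inv_sq_le (n : ℕ) : ∑ p ∈ n.primesLE, ((p : ℝ) ^ 2)⁻¹ ≤ 2 := by
  calc ∑ p ∈ n.primesLE, ((p : ℝ) ^ 2)⁻¹ ≤ ∑ i ∈ Finset.Ioo 0 (n + 1), ((i : ℝ) ^ 2)⁻¹ := by
        apply Finset.sum_le_sum_of_subset_of_nonneg
        · intro p hp
          rw [Nat.mem_primesLE] at hp
          simp [hp.2.pos]; omega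
        · intros; positivity
    _ ≤ _ := by simpa using sum_Ioo_inv_sq_le (α := ℝ) 0 (n + 1)

open ArithmeticFunction in
theorem sum_pow_cardFactors_div_le_exp {w : ℝ} (hw : 0 ≤ w) (hw2 : w < 2) (n : ℕ) :
    ∑ m ∈ Finset.Icc 1 n, w ^ cardFactors m / (m : ℝ) ≤
      Real.exp (w * ∑ p ∈ n.primesLE, (p : ℝ)⁻¹ + 2 * w ^ 2 / (1 - w / 2)) := by
  have hlt : ∀ p : ℕ, p.Prime → w * (p : ℝ)⁻¹ ≤ w / 2 := fun p hp => by
    have : (2 : ℝ) ≤ p := by exact_mod_cast hp.two_le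
    have := inv_anti₀ (by norm_num) this
    rw [div_eq_mul_inv]; gcongr
  have hf : ∀ p : ℕ, p.Prime → omegaTwist w 1 p = w * (p : ℝ)⁻¹ := fun p hp => by
    rw [omegaTwist_prime w 1 hp, Real.rpow_neg_one]
  have h1 := sum_le_prod_primesBelow (f := omegaTwist w 1) (omegaTwist_nonneg hw 1)
    (fun p hp => by rw [hf p hp]; linarith [hlt p hp]) (n + 1) (Finset.Icc 1 n) (by
      intro m hm
      rw [Finset.mem_Icc] at hm
      rw [Nat.mem_smoothNumbers']
      intro p hp hpm
      have := Nat.le_of_dvd (by omega) hpm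
      omega)
  calc ∑ m ∈ Finset.Icc 1 n, w ^ cardFactors m / (m : ℝ)
      = ∑ m ∈ Finset.Icc 1 n, omegaTwist w 1 m := by
        refine Finset.sum_congr rfl fun m hm => ?_
        rw [Finset.mem_Icc] at hm
        rw [omegaTwist_of_ne_zero w 1 (by omega), Real.rpow_neg_one, div_eq_mul_inv]
    _ ≤ ∏ p ∈ n.primesLE, (1 - omegaTwist w 1 p)⁻¹ := h1
    _ ≤ ∏ p ∈ n.primesLE, Real.exp (w * (p : ℝ)⁻¹ + w ^ 2 / (1 - w / 2) * ((p : ℝ) ^ 2)⁻¹) := by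
        refine Finset.prod_le_prod ?_ ?_
        · intro p hp
          rw [hf p (Nat.mem_primesLE.1 hp).2]
          have := hlt p (Nat.mem_primesLE.1 hp).2
          apply inv_nonneg.2; linarith
        · intro p hp
          have hp' := (Nat.mem_primesLE.1 hp).2
          rw [hf p hp']
          have := hlt p hp'
          refine (inv_one_sub_le_exp (by linarith)).trans (Real.exp_le_exp.2 ?_)
          have : (w * (p : ℝ)⁻¹) ^ 2 / (1 - w * (p : ℝ)⁻¹) ≤ (w * (p : ℝ)⁻¹) ^ 2 / (1 - w / 2) := by
            apply div_le_div_of_nonneg_left (by positivity) (by linarith) (by linarith)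
          have e : w ^ 2 / (1 - w / 2) * ((p : ℝ) ^ 2)⁻¹ = (w * (p : ℝ)⁻¹) ^ 2 / (1 - w / 2) := by
            rw [mul_pow, inv_pow]; ring
          rw [e]; linarith
    _ = Real.exp (w * ∑ p ∈ n.primesLE, (p : ℝ)⁻¹
          + w ^ 2 / (1 - w / 2) * ∑ p ∈ n.primesLE, ((p : ℝ) ^ 2)⁻¹) := by
        rw [← Real.exp_sum, Finset.sum_add_distrib, Finset.mul_sum, Finset.mul_sum]
    _ ≤ _ := by
        apply Real.exp_le_exp.2
        have := sum_primesLE_inv_sq_le n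
        have h0 : 0 ≤ w ^ 2 / (1 - w / 2) := div_nonneg (sq_nonneg _) (by linarith)
        have := mul_le_mul_of_nonneg_left this h0
        have e : w ^ 2 / (1 - w / 2) * 2 = 2 * w ^ 2 / (1 - w / 2) := by ring
        linarith

/-- Lower bound in Mertens' second theorem. -/
theorem log_log_sub_four_le_sum_primes_inv {x : ℝ} (hx : 1 < x) :
    Real.log (Real.log x) - 4 ≤ ∑ p ∈ ⌊x⌋₊.primesLE, (p : ℝ)⁻¹ := by
  have h := sum_pow_cardFactors_div_le_exp (w := 1) (by norm_num) (by norm_num) ⌊x⌋₊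
  have h1 : Real.log x ≤
      ∑ m ∈ Finset.Icc 1 ⌊x⌋₊, (1 : ℝ) ^ ArithmeticFunction.cardFactors m / m := by
    have h2 := log_add_one_le_harmonic ⌊x⌋₊
    rw [harmonic_eq_sum_Icc] at h2
    push_cast at h2
    simp only [one_pow, one_div]
    refine le_trans (Real.log_le_log (by linarith) ?_) h2
    exact (Nat.lt_floor_add_one x).le
  have h3 := Real.log_le_log (Real.log_pos hx) (h1.trans h)
  rw [Real.log_exp] at h3
  norm_num at h3
  linarith

/-- Upper bound in Mertens' first theorem. -/
theorem sum_primes_log_div_le (n : ℕ) :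
    ∑ p ∈ n.primesLE, Real.log p / p ≤ Real.log n + Real.log 4 := by
  rcases Nat.eq_zero_or_pos n with rfl | hn
  · simp [Nat.primesLE, Nat.primesBelow]
    have : Finset.filter Nat.Prime {0} = ∅ := by decide
    rw [this]; simp; exact Real.log_nonneg (by norm_num)
  have hn' : (0 : ℝ) < n := by exact_mod_cast hn
  -- `n log n ≥ ∑_{m ≤ n} log m ≥ ∑_{m ≤ n} ∑_{p ∣ m} log p = ∑_{p ≤ n} ⌊n / p⌋ log p`
  have h1 : ∑ p ∈ n.primesLE, ((n / p : ℕ) : ℝ) * Real.log p ≤ n * Real.log n := by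
    calc ∑ p ∈ n.primesLE, ((n / p : ℕ) : ℝ) * Real.log p
        = ∑ p ∈ n.primesLE, ∑ m ∈ Finset.Ioc 0 n, if p ∣ m then Real.log p else 0 := by
          refine Finset.sum_congr rfl fun p _ => ?_
          rw [← Finset.sum_filter, Finset.sum_const, Nat.Ioc_filter_dvd_card_eq_div, nsmul_eq_mul]
      _ = ∑ m ∈ Finset.Ioc 0 n, ∑ p ∈ n.primesLE, if p ∣ m then Real.log p else 0 :=
          Finset.sum_comm
      _ ≤ ∑ m ∈ Finset.Ioc 0 n, Real.log n := by
          refine Finset.sum_le_sum fun m hm => ?_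
          rw [Finset.mem_Ioc] at hm
          rw [← Finset.sum_filter]
          have e : {p ∈ n.primesLE | p ∣ m} = m.primeFactors := by
            ext p
            rw [Finset.mem_filter, Nat.mem_primesLE, Nat.mem_primeFactors]
            constructor
            · rintro ⟨⟨_, h⟩, h'⟩; exact ⟨h, h', by omega⟩
            · rintro ⟨h, h', _⟩
              exact ⟨⟨(Nat.le_of_dvd hm.1 h').trans hm.2, h⟩, h'⟩
          rw [e, ← Real.log_prod (fun p hp => by
            have := (Nat.prime_of_mem_primeFactors hp).ne_zero; exact_mod_cast this)]
          apply Real.log_le_log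
          · exact Finset.prod_pos fun p hp => by
              have := (Nat.prime_of_mem_primeFactors hp).pos; exact_mod_cast this
          · rw [← Nat.cast_prod]
            exact_mod_cast (Nat.le_of_dvd hm.1 (Nat.prod_primeFactors_dvd m)).trans hm.2
      _ = n * Real.log n := by simp
  have h2 : Chebyshev.theta n ≤ Real.log 4 * n := Chebyshev.theta_le_log4_mul_x hn'.le
  rw [Chebyshev.theta_eq_sum_primesLE_log] at h2
  have h3 : n * ∑ p ∈ n.primesLE, Real.log p / p ≤
      ∑ p ∈ n.primesLE, ((n / p : ℕ) : ℝ) * Real.log p + ∑ p ∈ n.primesLE, Real.log p := by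
    rw [Finset.mul_sum, ← Finset.sum_add_distrib]
    refine Finset.sum_le_sum fun p hp => ?_
    have hp' := (Nat.mem_primesLE.1 hp).2
    have hl : 0 ≤ Real.log p := Real.log_natCast_nonneg p
    have : (n : ℝ) / p ≤ (n / p : ℕ) + 1 := by
      rw [← Nat.floor_div_eq_div (K := ℝ)]
      exact (Nat.lt_floor_add_one _).le
    calc (n : ℝ) * (Real.log p / p) = (n / p) * Real.log p := by ring
      _ ≤ ((n / p : ℕ) + 1) * Real.log p := by gcongr
      _ = _ := by ring
  have h4 : n * ∑ p ∈ n.primesLE, Real.log p / p ≤ n * (Real.log n + Real.log 4) := by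
    linarith
  exact le_of_mul_le_mul_left h4 hn'

theorem sum_Icc_rpow_neg_le {σ : ℝ} (hσ : 1 < σ) (n : ℕ) :
    ∑ m ∈ Finset.Icc 1 n, (m : ℝ) ^ (-σ) ≤ 1 + 1 / (σ - 1) := by
  have hs : 0 < σ - 1 := by linarith
  rcases Nat.eq_zero_or_pos n with rfl | hn
  · simp; positivity
  obtain ⟨a, rfl⟩ : ∃ a, n = a + 1 := ⟨n - 1, by omega⟩
  have hanti : AntitoneOn (fun t : ℝ => t ^ (-σ)) (Set.Icc 1 (1 + a)) := by
    intro s hs' t ht hst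
    exact Real.rpow_le_rpow_of_nonpos (by linarith [hs'.1]) hst (by linarith)
  have h1 := hanti.sum_le_integral
  rw [integral_rpow (Or.inr ⟨by linarith, by
    rw [Set.uIcc_of_le (by simp)]; intro h; linarith [h.1]⟩)] at h1
  have e : ∑ m ∈ Finset.Icc 1 (a + 1), (m : ℝ) ^ (-σ)
      = 1 + ∑ i ∈ Finset.range a, (1 + ((i + 1 : ℕ) : ℝ)) ^ (-σ) := by
    clear h1 hanti hn
    induction a with
    | zero => simp
    | succ a ih =>
      rw [Finset.sum_Icc_succ_top (by omega), ih, Finset.sum_range_succ]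
      push_cast
      ring_nf
  rw [e]
  have h2 : 0 ≤ (1 + (a : ℝ)) ^ (-σ + 1) := by positivity
  have e2 : ((1 + (a : ℝ)) ^ (-σ + 1) - 1 ^ (-σ + 1)) / (-σ + 1)
      = (1 - (1 + (a : ℝ)) ^ (-σ + 1)) / (σ - 1) := by
    rw [Real.one_rpow, ← neg_div_neg_eq]; congr 1 <;> ring
  rw [e2] at h1
  have h3 : (1 - (1 + (a : ℝ)) ^ (-σ + 1)) / (σ - 1) ≤ 1 / (σ - 1) := by gcongr; linarith
  linarith

/-- Upper bound in Mertens' second theorem. -/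
theorem exists_sum_primes_inv_le : ∃ C : ℝ, 0 ≤ C ∧ ∀ x : ℝ, 2 ≤ x →
    ∑ p ∈ ⌊x⌋₊.primesLE, (p : ℝ)⁻¹ ≤ Real.log (Real.log x) + C := by
  refine ⟨Real.log (1 + 1 / Real.log 2) + (1 + Real.log 4 / Real.log 2), ?_, ?_⟩
  · have h2 : 0 < Real.log 2 := Real.log_pos (by norm_num)
    have h4 : 0 < Real.log 4 := Real.log_pos (by norm_num)
    have : 0 ≤ Real.log (1 + 1 / Real.log 2) := Real.log_nonneg (by simp; positivity)
    positivity
  intro x hx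
  set n := ⌊x⌋₊ with hn
  have hn2 : 2 ≤ n := Nat.le_floor (by exact_mod_cast hx)
  have hnx : (n : ℝ) ≤ x := Nat.floor_le (by linarith)
  have hl2 : 0 < Real.log 2 := Real.log_pos (by norm_num)
  have hn2' : (2 : ℝ) ≤ n := by exact_mod_cast hn2
  have hln2 : Real.log 2 ≤ Real.log n := Real.log_le_log (by norm_num) hn2'
  have hln : 0 < Real.log n := by linarith
  have hlnx : Real.log n ≤ Real.log x := Real.log_le_log (by linarith) hnx
  set σ : ℝ := 1 + 1 / Real.log n with hσ
  have hσ1 : 1 < σ := by rw [hσ]; linarith [one_div_pos.2 hln]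
  have hlt : ∀ p : ℕ, p.Prime → (p : ℝ) ^ (-σ) < 1 := fun p hp =>
    Real.rpow_lt_one_of_one_lt_of_neg (by exact_mod_cast hp.one_lt) (by linarith)
  have hf : ∀ p : ℕ, p.Prime → omegaTwist 1 σ p = (p : ℝ) ^ (-σ) := fun p hp => by
    rw [omegaTwist_prime 1 σ hp, one_mul]
  -- compare with the zeta function at `1 + 1 / log n`
  have h1 : ∏ p ∈ n.primesLE, (1 - omegaTwist 1 σ p)⁻¹ ≤ 1 + Real.log n := by
    have H := (EulerProduct.summable_and_hasSum_smoothNumbers_prod_primesBelow_geometric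
      (f := omegaTwist 1 σ) (fun {p} hp => by
        rw [Real.norm_of_nonneg (omegaTwist_nonneg zero_le_one σ p), hf p hp]
        exact hlt p hp) (n + 1)).2
    refine H.tsum_eq.symm.trans_le (H.summable.tsum_le_of_sum_le fun s => ?_)
    set t := s.map (Function.Embedding.subtype _) with ht
    have hst : ∑ i ∈ s, omegaTwist 1 σ (i : ℕ) = ∑ m ∈ t, omegaTwist 1 σ m := by
      rw [ht, Finset.sum_map]; rfl
    rw [hst]
    have ht0 : ∀ m ∈ t, m ≠ 0 := by
      intro m hm
      rw [ht, Finset.mem_map] at hm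
      obtain ⟨a, _, rfl⟩ := hm
      exact Nat.ne_zero_of_mem_smoothNumbers a.2
    calc ∑ m ∈ t, omegaTwist 1 σ m ≤ ∑ m ∈ Finset.Icc 1 (t.sup id), omegaTwist 1 σ m := by
          apply Finset.sum_le_sum_of_subset_of_nonneg
          · intro m hm
            rw [Finset.mem_Icc]
            exact ⟨Nat.one_le_iff_ne_zero.2 (ht0 m hm), Finset.le_sup (f := id) hm⟩
          · intros; exact omegaTwist_nonneg zero_le_one σ _
      _ = ∑ m ∈ Finset.Icc 1 (t.sup id), (m : ℝ) ^ (-σ) := by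
          refine Finset.sum_congr rfl fun m hm => ?_
          rw [Finset.mem_Icc] at hm
          rw [omegaTwist_of_ne_zero 1 σ (by omega), one_pow, one_mul]
      _ ≤ 1 + 1 / (σ - 1) := sum_Icc_rpow_neg_le hσ1 _
      _ = 1 + Real.log n := by rw [hσ]; simp
  have h2 : Real.exp (∑ p ∈ n.primesLE, (p : ℝ) ^ (-σ)) ≤ 1 + Real.log n := by
    refine le_trans ?_ h1
    rw [Real.exp_sum]
    refine Finset.prod_le_prod (fun _ _ => (Real.exp_pos _).le) fun p hp => ?_
    have hp' := (Nat.mem_primesLE.1 hp).2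
    rw [hf p hp']
    exact exp_le_inv_one_sub (hlt p hp')
  have h3 : ∑ p ∈ n.primesLE, (p : ℝ) ^ (-σ) ≤
      Real.log (Real.log x) + Real.log (1 + 1 / Real.log 2) := by
    have h4 := Real.log_le_log (Real.exp_pos _) h2
    rw [Real.log_exp] at h4
    refine h4.trans ?_
    rw [← Real.log_mul (by linarith) (by positivity)]
    apply Real.log_le_log (by linarith)
    have : 1 ≤ Real.log x / Real.log 2 := by rw [le_div_iff₀ hl2]; linarith
    calc 1 + Real.log n ≤ Real.log x / Real.log 2 + Real.log x := by linarith
      _ = _ := by ring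
  have h5 : ∑ p ∈ n.primesLE, (p : ℝ)⁻¹ ≤ ∑ p ∈ n.primesLE, (p : ℝ) ^ (-σ)
      + (∑ p ∈ n.primesLE, Real.log p / p) / Real.log n := by
    rw [Finset.sum_div, ← Finset.sum_add_distrib]
    refine Finset.sum_le_sum fun p hp => ?_
    have hp' := (Nat.mem_primesLE.1 hp).2
    have hp0 : (0 : ℝ) < p := by exact_mod_cast hp'.pos
    have e : (p : ℝ) ^ (-σ) = (p : ℝ)⁻¹ * Real.exp (-(Real.log p / Real.log n)) := by
      rw [hσ, neg_add, Real.rpow_add hp0, Real.rpow_neg_one, Real.rpow_def_of_pos hp0]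
      congr 2; ring
    have h6 := Real.add_one_le_exp (-(Real.log p / Real.log n))
    have h7 := mul_le_mul_of_nonneg_left h6 (inv_nonneg.2 hp0.le)
    rw [e]
    have e2 : Real.log p / p / Real.log n = (p : ℝ)⁻¹ * (Real.log p / Real.log n) := by ring
    rw [e2]; linarith
  have h8 : (∑ p ∈ n.primesLE, Real.log p / p) / Real.log n ≤ 1 + Real.log 4 / Real.log 2 := by
    have h9 := sum_primes_log_div_le n
    rw [div_le_iff₀ hln]
    have : Real.log 4 ≤ Real.log 4 / Real.log 2 * Real.log n := by
      rw [div_mul_eq_mul_div, le_div_iff₀ hl2]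
      exact mul_le_mul_of_nonneg_left hln2 (Real.log_nonneg (by norm_num))
    linarith
  linarith

open ArithmeticFunction in
/-- The sum of `w ^ Ω(m) / m` is at most of order `(log x) ^ w`. The restriction `w < 2` keeps the
Euler factor at `2` convergent. -/
theorem exists_sum_pow_cardFactors_div_le {w : ℝ} (hw : 0 ≤ w) (hw2 : w < 2) :
    ∃ C : ℝ, 0 < C ∧ ∀ x : ℝ, 2 ≤ x →
      ∑ m ∈ Finset.Icc 1 ⌊x⌋₊, w ^ cardFactors m / (m : ℝ) ≤ C * Real.log x ^ w := by
  obtain ⟨C, hC, h⟩ := exists_sum_primes_inv_le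
  refine ⟨Real.exp (w * C + 2 * w ^ 2 / (1 - w / 2)), Real.exp_pos _, fun x hx => ?_⟩
  refine (sum_pow_cardFactors_div_le_exp hw hw2 ⌊x⌋₊).trans ?_
  rw [Real.rpow_def_of_pos (Real.log_pos (by linarith)), ← Real.exp_add]
  apply Real.exp_le_exp.2
  have := mul_le_mul_of_nonneg_left (h x hx) hw
  linarith

/-! ### Smooth numbers -/

/-- Rankin's bound for the number of `y`-smooth integers up to `x`. -/
theorem exists_card_smoothNumbers_le : ∃ C : ℝ, 0 < C ∧ ∀ x y : ℝ, 1 ≤ x → 8 ≤ y →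
    (((Finset.Icc 1 ⌊x⌋₊).filter (fun m => m ∈ (⌊y⌋₊ + 1).smoothNumbers)).card : ℝ) ≤
      C * x * Real.exp (-(Real.log x / Real.log y)) * Real.log y ^ 11 := by
  obtain ⟨C, hC, hP⟩ := exists_sum_primes_inv_le
  refine ⟨Real.exp (11 * C), Real.exp_pos _, fun x y hx hy => ?_⟩
  have hx0 : 0 < x := by linarith
  have hly : 2 ≤ Real.log y := by
    rw [Real.le_log_iff_exp_le (by linarith)]
    have h1 := Real.exp_one_lt_d9
    have h2 : Real.exp 2 = Real.exp 1 * Real.exp 1 := by rw [← Real.exp_add]; norm_num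
    have h3 := Real.exp_pos 1
    rw [h2]; nlinarith
  have hly0 : 0 < Real.log y := by linarith
  set σ : ℝ := 1 - 1 / Real.log y with hσ
  have hσ2 : 1 / 2 ≤ σ := by
    have := one_div_le_one_div_of_le (by norm_num) hly
    rw [hσ]; linarith
  have hf : ∀ p : ℕ, p.Prime → omegaTwist 1 σ p = (p : ℝ) ^ (-σ) := fun p hp => by
    rw [omegaTwist_prime 1 σ hp, one_mul]
  have hle : ∀ p : ℕ, p.Prime → (p : ℝ) ^ (-σ) ≤ 3 / 4 := fun p hp => by
    have hp2 : (2 : ℝ) ≤ p := by exact_mod_cast hp.two_le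
    calc (p : ℝ) ^ (-σ) ≤ (p : ℝ) ^ (-(1 / 2) : ℝ) :=
          Real.rpow_le_rpow_of_exponent_le (by linarith) (by linarith)
      _ ≤ (2 : ℝ) ^ (-(1 / 2) : ℝ) := Real.rpow_le_rpow_of_nonpos (by norm_num) hp2 (by norm_num)
      _ ≤ 3 / 4 := by
          rw [Real.rpow_neg (by norm_num), ← Real.sqrt_eq_rpow]
          rw [inv_le_comm₀ (by positivity) (by norm_num)]
          apply Real.le_sqrt_of_sq_le; norm_num
  have hle' : ∀ p : ℕ, p.Prime → (p : ℝ) ≤ y → (p : ℝ) ^ (-σ) ≤ Real.exp 1 * (p : ℝ)⁻¹ := by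
    intro p hp hpy
    have hp0 : (0 : ℝ) < p := by exact_mod_cast hp.pos
    have e : (p : ℝ) ^ (-σ) = Real.exp (Real.log p / Real.log y) * (p : ℝ)⁻¹ := by
      rw [hσ, neg_sub, sub_eq_add_neg, Real.rpow_add hp0, Real.rpow_neg_one,
        Real.rpow_def_of_pos hp0]
      congr 2; ring
    rw [e]
    gcongr
    rw [div_le_one hly0]
    exact Real.log_le_log hp0 hpy
  -- Rankin's trick: `1 ≤ (x / m) ^ σ`
  calc (((Finset.Icc 1 ⌊x⌋₊).filter (fun m => m ∈ (⌊y⌋₊ + 1).smoothNumbers)).card : ℝ)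
      = ∑ m ∈ (Finset.Icc 1 ⌊x⌋₊).filter (fun m => m ∈ (⌊y⌋₊ + 1).smoothNumbers), (1 : ℝ) := by
        simp
    _ ≤ ∑ m ∈ (Finset.Icc 1 ⌊x⌋₊).filter (fun m => m ∈ (⌊y⌋₊ + 1).smoothNumbers),
          x ^ σ * omegaTwist 1 σ m := by
        refine Finset.sum_le_sum fun m hm => ?_
        rw [Finset.mem_filter, Finset.mem_Icc] at hm
        have hm0 : (0 : ℝ) < m := by exact_mod_cast hm.1.1
        have hmx : (m : ℝ) ≤ x := (Nat.le_floor_iff hx0.le).1 hm.1.2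
        rw [omegaTwist_of_ne_zero 1 σ (by omega), one_pow, one_mul, Real.rpow_neg hm0.le,
          ← div_eq_mul_inv, ← Real.div_rpow hx0.le hm0.le]
        apply Real.one_le_rpow _ (by linarith)
        rwa [one_le_div hm0]
    _ = x ^ σ * ∑ m ∈ (Finset.Icc 1 ⌊x⌋₊).filter (fun m => m ∈ (⌊y⌋₊ + 1).smoothNumbers),
          omegaTwist 1 σ m := by rw [Finset.mul_sum]
    _ ≤ x ^ σ * ∏ p ∈ ⌊y⌋₊.primesLE, (1 - omegaTwist 1 σ p)⁻¹ := by
        gcongr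
        refine sum_le_prod_primesBelow (omegaTwist_nonneg zero_le_one σ) (fun p hp => ?_) _ _
          fun m hm => (Finset.mem_filter.1 hm).2
        rw [hf p hp]; linarith [hle p hp]
    _ ≤ x ^ σ * ∏ p ∈ ⌊y⌋₊.primesLE, Real.exp (11 * (p : ℝ)⁻¹) := by
        gcongr with p hp
        · intro p hp
          have hp' := (Nat.mem_primesLE.1 hp).2
          rw [hf p hp', inv_nonneg]; linarith [hle p hp']
        · have hp' := (Nat.mem_primesLE.1 hp).2
          have hpy : (p : ℝ) ≤ y := (Nat.le_floor_iff (by linarith)).1 (Nat.mem_primesLE.1 hp).1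
          rw [hf p hp']
          have h1 := hle p hp'
          have h2 := hle' p hp' hpy
          have h0 : 0 ≤ (p : ℝ) ^ (-σ) := by positivity
          set t := (p : ℝ) ^ (-σ)
          refine (inv_one_sub_le_exp (by linarith)).trans (Real.exp_le_exp.2 ?_)
          have h3 : t + t ^ 2 / (1 - t) ≤ 4 * t := by
            have : t ^ 2 / (1 - t) ≤ 3 * t := by
              rw [div_le_iff₀ (by linarith)]; nlinarith
            linarith
          have h4 : 0 ≤ (p : ℝ)⁻¹ := by positivity
          have h5 := Real.exp_one_lt_d9
          nlinarith
    _ = x ^ σ * Real.exp (11 * ∑ p ∈ ⌊y⌋₊.primesLE, (p : ℝ)⁻¹) := by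
        rw [← Real.exp_sum, Finset.mul_sum]
    _ ≤ x ^ σ * Real.exp (11 * (Real.log (Real.log y) + C)) := by
        gcongr
        exact hP y (by linarith)
    _ = _ := by
        have e1 : x ^ σ = x * Real.exp (-(Real.log x / Real.log y)) := by
          rw [hσ, sub_eq_add_neg, Real.rpow_add hx0, Real.rpow_one, Real.rpow_def_of_pos hx0]
          congr 2; ring
        have e2 : Real.exp (11 * (Real.log (Real.log y) + C))
            = Real.exp (11 * C) * Real.log y ^ 11 := by
          rw [mul_add, Real.exp_add, mul_comm (Real.exp _)]
          congr 1
          rw [show (11 : ℝ) = ((11 : ℕ) : ℝ) by norm_num, Real.exp_nat_mul, Real.exp_log hly0]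
        rw [e1, e2]; ring

/-! ### Brun's pure sieve -/

/-- Bonferroni inequality: truncating the inclusion-exclusion sum at an even level overestimates. -/
theorem ite_eq_empty_le_truncated_alternating_sum {ι : Type*} [DecidableEq ι] (s : Finset ι) {r : ℕ}
    (hr : Even r) :
    (if s = ∅ then (1 : ℝ) else 0) ≤
      ∑ T ∈ s.powerset with T.card ≤ r, (-1 : ℝ) ^ T.card := by
  have h1 : ∑ T ∈ s.powerset with T.card ≤ r, (-1 : ℝ) ^ T.card
      = ∑ k ∈ Finset.range (r + 1), (-1 : ℝ) ^ k * (s.card.choose k : ℝ) := by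
    rw [← Finset.sum_fiberwise_of_maps_to (s := s.powerset.filter (fun T => T.card ≤ r))
      (t := Finset.range (r + 1)) (g := Finset.card) (by simp)]
    refine Finset.sum_congr rfl fun k hk => ?_
    have e : ((s.powerset.filter (fun T => T.card ≤ r)).filter (fun T => T.card = k)) =
        s.powersetCard k := by
      ext T
      simp only [Finset.mem_filter, Finset.mem_powerset, Finset.mem_powersetCard]
      simp at hk
      constructor
      · rintro ⟨⟨h, _⟩, h'⟩; exact ⟨h, h'⟩
      · rintro ⟨h, h'⟩; exact ⟨⟨h, by omega⟩, h'⟩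
    rw [e, Finset.sum_congr rfl (g := fun _ => (-1 : ℝ) ^ k)
        (fun T hT => by rw [(Finset.mem_powersetCard.1 hT).2]),
      Finset.sum_const, Finset.card_powersetCard, nsmul_eq_mul, mul_comm]
  rw [h1]
  split_ifs with h
  · subst h
    rw [Finset.sum_range_succ']
    simp
  · obtain ⟨n, hn⟩ : ∃ n, s.card = n + 1 := ⟨s.card - 1, by
      have := Finset.card_pos.2 (Finset.nonempty_iff_ne_empty.2 h); omega⟩
    have h2 := Int.alternating_sum_range_choose_eq_choose (n := n) (m := r)
    rw [hr.neg_one_pow, one_mul] at h2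
    have h3 : ∑ k ∈ Finset.range (r + 1), (-1 : ℝ) ^ k * (s.card.choose k : ℝ) =
        (n.choose r : ℝ) := by
      rw [hn]; exact_mod_cast h2
    rw [h3]; positivity

theorem abs_card_filter_modEq_sub_le (N : ℕ) {m : ℕ} (hm : 0 < m) (v : ℕ) :
    |(((Finset.Ioc 0 N).filter (fun n : ℕ => n ≡ v [MOD m])).card : ℝ) - N / m| ≤ 1 := by
  have h := Nat.Ioc_filter_modEq_card 0 N hm v
  have hm' : (0 : ℚ) < m := by exact_mod_cast hm
  set a : ℚ := (N - v) / m with ha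
  set b : ℚ := ((0 : ℕ) - v) / m with hb
  have hab : a - b = N / m := by rw [ha, hb]; field_simp; simp
  have hle : b ≤ a := by
    have : (0 : ℚ) ≤ N / m := by positivity
    linarith
  rw [max_eq_left (sub_nonneg.2 (Int.floor_le_floor hle))] at h
  have h' : (((Finset.Ioc 0 N).filter (fun n : ℕ => n ≡ v [MOD m])).card : ℚ) = ⌊a⌋ - ⌊b⌋ := by
    exact_mod_cast h
  have key : |(((Finset.Ioc 0 N).filter (fun n : ℕ => n ≡ v [MOD m])).card : ℚ) - N / m| ≤ 1 := by
    rw [h', abs_le]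
    constructor <;> linarith [Int.floor_le a, Int.floor_le b, Int.lt_floor_add_one a,
      Int.lt_floor_add_one b]
  have key' := (Rat.cast_le (K := ℝ)).2 key
  push_cast at key'
  exact key'

/-- Equidistribution of `{1, …, N}` among the residue classes modulo pairwise coprime moduli. The
class `v` modulo `m` is there to make the induction on `T` work. -/
theorem abs_card_filter_modEq_forall_sub_le (N : ℕ) (A : (p : ℕ) → Finset (ZMod p)) (T : Finset ℕ)
    (hT : ∀ p ∈ T, p.Prime) (m : ℕ) (hm : 0 < m) (hc : ∀ p ∈ T, m.Coprime p) (v : ℕ) :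
    |(((Finset.Ioc 0 N).filter (fun n : ℕ => n ≡ v [MOD m] ∧
        ∀ p ∈ T, (n : ZMod p) ∈ A p)).card : ℝ)
      - N / m * ∏ p ∈ T, ((A p).card : ℝ) / p| ≤ ∏ p ∈ T, ((A p).card : ℝ) := by
  induction T using Finset.induction_on generalizing m v with
  | empty => simpa using abs_card_filter_modEq_sub_le N hm v
  | insert p T hpT ih =>
    have hp : p.Prime := hT p (Finset.mem_insert_self p T)
    have hp0 : NeZero p := ⟨hp.ne_zero⟩
    have hmp : m.Coprime p := hc p (Finset.mem_insert_self p T)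
    have hcT : ∀ q ∈ T, (m * p).Coprime q := fun q hq => by
      refine Nat.Coprime.mul_left (hc q (Finset.mem_insert_of_mem hq)) ?_
      rw [Nat.coprime_primes hp (hT q (Finset.mem_insert_of_mem hq))]
      rintro rfl; exact hpT hq
    let w : ZMod p → ℕ := fun a => (Nat.chineseRemainder hmp v a.val : ℕ)
    have hw : ∀ (a : ZMod p) (n : ℕ), n ≡ w a [MOD m * p] ↔ n ≡ v [MOD m] ∧ (n : ZMod p) = a := by
      intro a n
      have h1 := (Nat.chineseRemainder hmp v a.val).2
      rw [← Nat.modEq_and_modEq_iff_modEq_mul hmp]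
      have e : (n : ZMod p) = a ↔ n ≡ a.val [MOD p] := by
        rw [← ZMod.natCast_eq_natCast_iff, ZMod.natCast_zmod_val]
      rw [e]
      constructor
      · rintro ⟨h2, h3⟩; exact ⟨h2.trans h1.1, h3.trans h1.2⟩
      · rintro ⟨h2, h3⟩; exact ⟨h2.trans h1.1.symm, h3.trans h1.2.symm⟩
    have hcard : (((Finset.Ioc 0 N).filter (fun n : ℕ => n ≡ v [MOD m] ∧
        ∀ q ∈ insert p T, (n : ZMod q) ∈ A q)).card : ℝ) =
        ∑ a ∈ A p, (((Finset.Ioc 0 N).filter (fun n : ℕ => n ≡ w a [MOD m * p] ∧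
          ∀ q ∈ T, (n : ZMod q) ∈ A q)).card : ℝ) := by
      rw [Finset.card_eq_sum_card_fiberwise (f := fun n : ℕ => (n : ZMod p)) (t := A p)]
      · push_cast
        refine Finset.sum_congr rfl fun a ha => ?_
        congr 2
        ext n
        simp only [Finset.mem_filter, Finset.forall_mem_insert, hw]
        constructor
        · rintro ⟨⟨h1, h2, h3, h4⟩, h5⟩; exact ⟨h1, ⟨h2, h5⟩, h4⟩
        · rintro ⟨h1, ⟨h2, h5⟩, h4⟩; exact ⟨⟨h1, h2, h5 ▸ ha, h4⟩, h5⟩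
      · intro n hn
        exact (Finset.mem_filter.1 hn).2.2 p (Finset.mem_insert_self p T)
    rw [hcard, Finset.prod_insert hpT, Finset.prod_insert hpT]
    have e : (N : ℝ) / m * (((A p).card : ℝ) / p * ∏ q ∈ T, ((A q).card : ℝ) / q)
        = ∑ a ∈ A p, ((N : ℝ) / (m * p : ℕ) * ∏ q ∈ T, ((A q).card : ℝ) / q) := by
      have hp' : (p : ℝ) ≠ 0 := by exact_mod_cast hp.ne_zero
      have hm' : (m : ℝ) ≠ 0 := by exact_mod_cast hm.ne'
      rw [Finset.sum_const, nsmul_eq_mul, Nat.cast_mul]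
      generalize ∏ q ∈ T, ((A q).card : ℝ) / q = Z
      field_simp
    rw [e, ← Finset.sum_sub_distrib]
    refine (Finset.abs_sum_le_sum_abs _ _).trans ?_
    rw [← nsmul_eq_mul, ← Finset.sum_const]
    exact Finset.sum_le_sum fun a _ => ih (fun q hq => hT q (Finset.mem_insert_of_mem hq)) (m * p)
      (Nat.mul_pos hm hp.pos) hcT (w a)

theorem abs_card_filter_forall_sub_le (N : ℕ) (A : (p : ℕ) → Finset (ZMod p)) (T : Finset ℕ)
    (hT : ∀ p ∈ T, p.Prime) :
    |(((Finset.Ioc 0 N).filter (fun n : ℕ => ∀ p ∈ T, (n : ZMod p) ∈ A p)).card : ℝ)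
      - N * ∏ p ∈ T, ((A p).card : ℝ) / p| ≤ ∏ p ∈ T, ((A p).card : ℝ) := by
  simpa [Nat.modEq_one] using
    abs_card_filter_modEq_forall_sub_le N A T hT 1 one_pos (fun p _ => Nat.coprime_one_left p) 0

theorem sum_powerset_prod_le_exp {ι : Type*} (s : Finset ι) (g : ι → ℝ)
    (hg : ∀ i ∈ s, 0 ≤ g i) : ∑ T ∈ s.powerset, ∏ i ∈ T, g i ≤ Real.exp (∑ i ∈ s, g i) := by
  rw [← Finset.prod_one_add, Real.exp_sum]
  refine Finset.prod_le_prod (fun i hi => by linarith [hg i hi]) fun i _ => ?_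
  linarith [Real.add_one_le_exp (g i)]

/-- Rankin's trick for the sum of the products over the subsets of at most `r` elements. -/
theorem sum_powerset_card_le_prod_le {ι : Type*} (P : Finset ι) (a : ι → ℝ) (ha : ∀ i ∈ P, 0 ≤ a i)
    {M : ℝ} (hM : 1 ≤ M) (haM : ∑ i ∈ P, a i ≤ M) (r : ℕ) :
    ∑ T ∈ P.powerset with T.card ≤ r, ∏ i ∈ T, a i ≤ Real.exp 1 * M ^ r := by
  have hM0 : 0 < M := by linarith
  have hpos : ∀ T ∈ P.powerset, 0 ≤ ∏ i ∈ T, a i / M := fun T hT =>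
    Finset.prod_nonneg fun i hi => div_nonneg (ha i (Finset.mem_powerset.1 hT hi)) hM0.le
  calc ∑ T ∈ P.powerset with T.card ≤ r, ∏ i ∈ T, a i
      ≤ ∑ T ∈ P.powerset with T.card ≤ r, M ^ r * ∏ i ∈ T, a i / M := by
        refine Finset.sum_le_sum fun T hT => ?_
        have hT' := Finset.mem_filter.1 hT
        have e : ∏ i ∈ T, a i = M ^ T.card * ∏ i ∈ T, a i / M := by
          rw [Finset.prod_div_distrib, Finset.prod_const]
          field_simp
        rw [e]
        exact mul_le_mul_of_nonneg_right (pow_le_pow_right₀ hM hT'.2) (hpos T hT'.1)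
    _ ≤ ∑ T ∈ P.powerset, M ^ r * ∏ i ∈ T, a i / M :=
        Finset.sum_le_sum_of_subset_of_nonneg (Finset.filter_subset _ _) fun T hT _ =>
          mul_nonneg (pow_nonneg hM0.le r) (hpos T hT)
    _ ≤ M ^ r * Real.exp (∑ i ∈ P, a i / M) := by
        rw [← Finset.mul_sum]
        exact mul_le_mul_of_nonneg_left
          (sum_powerset_prod_le_exp P _ fun i hi => div_nonneg (ha i hi) hM0.le)
          (pow_nonneg hM0.le r)
    _ ≤ M ^ r * Real.exp 1 := by
        refine mul_le_mul_of_nonneg_left (Real.exp_le_exp.2 ?_) (pow_nonneg hM0.le r)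
        rw [← Finset.sum_div, div_le_one hM0]; exact haM
    _ = _ := mul_comm _ _

/-- **Brun's pure sieve.** Removing from `{1, …, N}`, for each `p ∈ P`, the residue classes in `A p`
leaves at most the expected number of elements, up to the error terms coming from the truncation of
inclusion-exclusion to sets of at most `r` primes. -/
theorem card_sifted_le (N : ℕ) (A : (p : ℕ) → Finset (ZMod p)) (P : Finset ℕ)
    (hP : ∀ p ∈ P, p.Prime) {r : ℕ} (hr : Even r) {M : ℝ} (hM : 1 ≤ M)
    (hAM : ∑ p ∈ P, ((A p).card : ℝ) ≤ M) (hAp : ∀ p ∈ P, (A p).card ≤ p) :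
    (((Finset.Ioc 0 N).filter (fun n : ℕ => ∀ p ∈ P, (n : ZMod p) ∉ A p)).card : ℝ) ≤
      N * (Real.exp (-∑ p ∈ P, ((A p).card : ℝ) / p) +
        Real.exp (-r) * Real.exp (Real.exp 1 * ∑ p ∈ P, ((A p).card : ℝ) / p)) +
      Real.exp 1 * M ^ r := by
  classical
  set g : ℕ → ℝ := fun p => ((A p).card : ℝ) / p with hg
  have hg0 : ∀ p, 0 ≤ g p := fun p => by simp only [hg]; positivity
  have hg1 : ∀ p ∈ P, g p ≤ 1 := fun p hp => by
    have : (0 : ℝ) < p := by exact_mod_cast (hP p hp).pos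
    simp only [hg]
    rw [div_le_one this]; exact_mod_cast hAp p hp
  set Q := P.powerset.filter (fun T => T.card ≤ r) with hQ
  -- the truncated inclusion-exclusion inequality
  have h1 : (((Finset.Ioc 0 N).filter (fun n : ℕ => ∀ p ∈ P, (n : ZMod p) ∉ A p)).card : ℝ) ≤
      ∑ T ∈ Q, (-1 : ℝ) ^ T.card *
        ((Finset.Ioc 0 N).filter (fun n : ℕ => ∀ p ∈ T, (n : ZMod p) ∈ A p)).card := by
    rw [Finset.card_filter]
    push_cast
    calc ∑ n ∈ Finset.Ioc 0 N, (if ∀ p ∈ P, (n : ZMod p) ∉ A p then (1 : ℝ) else 0)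
        ≤ ∑ n ∈ Finset.Ioc 0 N, ∑ T ∈ Q,
            (-1 : ℝ) ^ T.card * (if ∀ p ∈ T, (n : ZMod p) ∈ A p then (1 : ℝ) else 0) := by
          refine Finset.sum_le_sum fun n _ => ?_
          have h := ite_eq_empty_le_truncated_alternating_sum
            (P.filter (fun p => (n : ZMod p) ∈ A p)) hr
          simp only [Finset.filter_eq_empty_iff] at h
          refine h.trans (le_of_eq ?_)
          simp only [mul_ite, mul_one, mul_zero]
          rw [← Finset.sum_filter]
          refine Finset.sum_congr ?_ fun _ _ => rfl
          ext T
          simp only [hQ, Finset.mem_filter, Finset.mem_powerset, Finset.subset_iff]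
          constructor
          · rintro ⟨h1, h2⟩; exact ⟨⟨fun x hx => (h1 hx).1, h2⟩, fun x hx => (h1 hx).2⟩
          · rintro ⟨⟨h1, h2⟩, h3⟩; exact ⟨fun x hx => ⟨h1 hx, h3 x hx⟩, h2⟩
      _ = _ := by
          rw [Finset.sum_comm]
          refine Finset.sum_congr rfl fun T _ => ?_
          rw [← Finset.mul_sum, Finset.card_filter]
          push_cast; rfl
  have h2 : ∑ T ∈ Q, (-1 : ℝ) ^ T.card *
        ((Finset.Ioc 0 N).filter (fun n : ℕ => ∀ p ∈ T, (n : ZMod p) ∈ A p)).card ≤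
      N * ∑ T ∈ Q, (-1 : ℝ) ^ T.card * ∏ p ∈ T, g p + ∑ T ∈ Q, ∏ p ∈ T, ((A p).card : ℝ) := by
    rw [Finset.mul_sum, ← Finset.sum_add_distrib]
    refine Finset.sum_le_sum fun T hT => ?_
    have hTP : T ⊆ P := Finset.mem_powerset.1 (Finset.mem_filter.1 hT).1
    have h3 := abs_card_filter_forall_sub_le N A T fun p hp => hP p (hTP hp)
    have h4 : |(-1 : ℝ) ^ T.card| = 1 := by simp
    have h5 := (le_abs_self ((-1 : ℝ) ^ T.card * ((((Finset.Ioc 0 N).filter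
      (fun n : ℕ => ∀ p ∈ T, (n : ZMod p) ∈ A p)).card : ℝ)
      - N * ∏ p ∈ T, ((A p).card : ℝ) / p)))
    rw [abs_mul, h4, one_mul] at h5
    have h6 := h5.trans h3
    rw [mul_sub] at h6
    have e : (N : ℝ) * ((-1) ^ T.card * ∏ p ∈ T, g p)
      = (-1) ^ T.card * (N * ∏ p ∈ T, ((A p).card : ℝ) / p) := by ring
    rw [e]; linarith
  -- Rankin's trick for the terms with `T.card > r`
  have h3 : ∑ T ∈ Q, (-1 : ℝ) ^ T.card * ∏ p ∈ T, g p ≤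
      Real.exp (-∑ p ∈ P, g p) + Real.exp (-r) * Real.exp (Real.exp 1 * ∑ p ∈ P, g p) := by
    have hfull : ∑ T ∈ P.powerset, (-1 : ℝ) ^ T.card * ∏ p ∈ T, g p ≤
        Real.exp (-∑ p ∈ P, g p) := by
      have e : ∑ T ∈ P.powerset, (-1 : ℝ) ^ T.card * ∏ p ∈ T, g p = ∏ p ∈ P, (1 + -g p) := by
        rw [Finset.prod_one_add]
        refine Finset.sum_congr rfl fun T _ => ?_
        rw [Finset.prod_neg, mul_comm]
      rw [e, ← Finset.sum_neg_distrib, Real.exp_sum]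
      refine Finset.prod_le_prod (fun p hp => by linarith [hg1 p hp]) fun p _ => ?_
      linarith [Real.add_one_le_exp (-g p)]
    have htail : ∑ T ∈ P.powerset.filter (fun T => ¬ T.card ≤ r),
          -((-1 : ℝ) ^ T.card * ∏ p ∈ T, g p)
        ≤ Real.exp (-r) * Real.exp (Real.exp 1 * ∑ p ∈ P, g p) := by
      calc ∑ T ∈ P.powerset.filter (fun T => ¬ T.card ≤ r), -((-1 : ℝ) ^ T.card * ∏ p ∈ T, g p)
          ≤ ∑ T ∈ P.powerset.filter (fun T => ¬ T.card ≤ r),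
              Real.exp (-r) * ∏ p ∈ T, (Real.exp 1 * g p) := by
            refine Finset.sum_le_sum fun T hT => ?_
            have hTr := (Finset.mem_filter.1 hT).2
            have hpos : 0 ≤ ∏ p ∈ T, g p := Finset.prod_nonneg fun p _ => hg0 p
            rw [Finset.prod_mul_distrib, Finset.prod_const, ← mul_assoc, ← neg_mul]
            refine mul_le_mul_of_nonneg_right ?_ hpos
            have h7 : (1 : ℝ) ≤ Real.exp (-r) * Real.exp 1 ^ T.card := by
              rw [← Real.exp_nat_mul, ← Real.exp_add]
              apply Real.one_le_exp
              have : (r : ℝ) ≤ T.card := by exact_mod_cast (not_le.1 hTr).le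
              linarith
            refine le_trans ?_ h7
            refine (neg_le_abs _).trans ?_
            simp
        _ ≤ ∑ T ∈ P.powerset, Real.exp (-r) * ∏ p ∈ T, (Real.exp 1 * g p) := by
            refine Finset.sum_le_sum_of_subset_of_nonneg (Finset.filter_subset _ _) fun T _ _ => ?_
            exact mul_nonneg (Real.exp_pos _).le
              (Finset.prod_nonneg fun p _ => mul_nonneg (Real.exp_pos _).le (hg0 p))
        _ ≤ _ := by
            rw [← Finset.mul_sum, Finset.mul_sum P]
            gcongr
            exact sum_powerset_prod_le_exp P _ fun p _ => mul_nonneg (Real.exp_pos _).le (hg0 p)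
    have hsplit := Finset.sum_filter_add_sum_filter_not P.powerset (fun T => T.card ≤ r)
      (fun T => (-1 : ℝ) ^ T.card * ∏ p ∈ T, g p)
    rw [Finset.sum_neg_distrib] at htail
    linarith
  have h4 : ∑ T ∈ Q, ∏ p ∈ T, ((A p).card : ℝ) ≤ Real.exp 1 * M ^ r :=
    sum_powerset_card_le_prod_le P (fun p => ((A p).card : ℝ)) (fun _ _ => Nat.cast_nonneg _) hM
      hAM r
  have h5 := mul_le_mul_of_nonneg_left h3 (Nat.cast_nonneg N : (0 : ℝ) ≤ N)
  linarith

/-! ### Prime values of linear forms -/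

theorem card_primeFactors_mul_log_two_le {B : ℕ} (hB : B ≠ 0) :
    (B.primeFactors.card : ℝ) * Real.log 2 ≤ Real.log B := by
  have h : 2 ^ B.primeFactors.card ≤ B := by
    calc 2 ^ B.primeFactors.card ≤ ∏ p ∈ B.primeFactors, p :=
          Finset.pow_card_le_prod _ _ _ fun p hp => (Nat.prime_of_mem_primeFactors hp).two_le
      _ ≤ B := Nat.le_of_dvd (Nat.pos_of_ne_zero hB) (Nat.prod_primeFactors_dvd B)
  rw [← Real.log_pow]
  apply Real.log_le_log (by positivity)
  exact_mod_cast h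

/-- The primes dividing `B` have a small reciprocal sum: those up to `t` are bounded by all primes
up to `t`, and there are at most `log B / log 2` others. -/
theorem sum_primeFactors_inv_le {B : ℕ} (hB : B ≠ 0) {t : ℝ} (ht : 0 < t) :
    ∑ p ∈ B.primeFactors, (p : ℝ)⁻¹ ≤
      ∑ p ∈ ⌊t⌋₊.primesLE, (p : ℝ)⁻¹ + Real.log B / Real.log 2 / t := by
  have hl2 : 0 < Real.log 2 := Real.log_pos (by norm_num)
  rw [← Finset.sum_filter_add_sum_filter_not B.primeFactors (fun p => p ≤ ⌊t⌋₊)]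
  apply add_le_add
  · apply Finset.sum_le_sum_of_subset_of_nonneg
    · intro p hp
      rw [Finset.mem_filter] at hp
      exact Nat.mem_primesLE.2 ⟨hp.2, Nat.prime_of_mem_primeFactors hp.1⟩
    · intros; positivity
  · calc ∑ p ∈ B.primeFactors with ¬ p ≤ ⌊t⌋₊, (p : ℝ)⁻¹
        ≤ ∑ p ∈ B.primeFactors with ¬ p ≤ ⌊t⌋₊, t⁻¹ := by
          refine Finset.sum_le_sum fun p hp => ?_
          rw [Finset.mem_filter, not_le] at hp
          exact inv_anti₀ ht ((Nat.floor_lt ht.le).1 hp.2).le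
      _ ≤ B.primeFactors.card * t⁻¹ := by
          rw [Finset.sum_const, nsmul_eq_mul]
          gcongr
          exact Finset.filter_subset _ _
      _ ≤ Real.log B / Real.log 2 / t := by
          rw [div_eq_mul_inv _ t]
          gcongr
          rw [le_div_iff₀ hl2]
          exact card_primeFactors_mul_log_two_le hB

/-- The bound `x ^ (1 / (13 log log x))` below which an integer counts as smooth. -/
noncomputable def smoothCutoff (x : ℝ) : ℝ :=
  Real.exp (Real.log x / (13 * Real.log (Real.log x)))

/-- The roots modulo `p` of the linear forms `n ↦ a i * n + b i`, for a prime `p` dividing none of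
the `a i`; the inverse in `ZMod p` takes a junk value otherwise. -/
def rootsMod {k : ℕ} (a b : Fin k → ℤ) (p : ℕ) : Finset (ZMod p) :=
  Finset.univ.image fun i => -(b i : ZMod p) * (a i : ZMod p)⁻¹

theorem card_rootsMod {k : ℕ} {a b : Fin k → ℤ} {p : ℕ} (hp : p.Prime)
    (ha : ∀ i, ¬ (p : ℤ) ∣ a i) (hab : ∀ i j, i ≠ j → ¬ (p : ℤ) ∣ a i * b j - a j * b i) :
    (rootsMod a b p).card = k := by
  have : Fact p.Prime := ⟨hp⟩
  have ha' : ∀ i, (a i : ZMod p) ≠ 0 := fun i h => ha i ((ZMod.intCast_zmod_eq_zero_iff_dvd _ _).1 h)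
  rw [rootsMod, Finset.card_image_of_injective, Finset.card_univ, Fintype.card_fin]
  intro i j hij
  by_contra hne
  apply hab i j hne
  rw [← ZMod.intCast_zmod_eq_zero_iff_dvd]
  push_cast
  have h1 := ha' i
  have h2 := ha' j
  simp only at hij
  field_simp at hij
  linear_combination hij

theorem dvd_of_mem_rootsMod {k : ℕ} {a b : Fin k → ℤ} {p : ℕ} (hp : p.Prime)
    (ha : ∀ i, ¬ (p : ℤ) ∣ a i) {n : ℕ} (hn : (n : ZMod p) ∈ rootsMod a b p) :
    ∃ i, (p : ℤ) ∣ a i * n + b i := by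
  have : Fact p.Prime := ⟨hp⟩
  rw [rootsMod, Finset.mem_image] at hn
  obtain ⟨i, _, hi⟩ := hn
  refine ⟨i, ?_⟩
  have ha' : (a i : ZMod p) ≠ 0 := fun h => ha i ((ZMod.intCast_zmod_eq_zero_iff_dvd _ _).1 h)
  rw [← ZMod.intCast_zmod_eq_zero_iff_dvd]
  push_cast
  rw [← hi]
  field_simp
  ring

/-- Leaving out the prime divisors of an integer `B ≤ e ^ (10 t)` costs at most `log log t + O(1)`
in the lower bound of Mertens' theorem. -/
theorem log_log_sub_le_sum_primes_not_dvd {C z t : ℝ}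
    (hC : ∀ x : ℝ, 2 ≤ x → ∑ p ∈ ⌊x⌋₊.primesLE, (p : ℝ)⁻¹ ≤ Real.log (Real.log x) + C)
    (hz : 1 < z) {B : ℕ} (hB0 : B ≠ 0) (ht : 2 ≤ t) (hB : (B : ℝ) ≤ Real.exp t ^ 10) :
    Real.log (Real.log z) - Real.log (Real.log t) - (19 + C) ≤
      ∑ p ∈ ⌊z⌋₊.primesLE with ¬ p ∣ B, (p : ℝ)⁻¹ := by
  have h1 := log_log_sub_four_le_sum_primes_inv hz
  have h2 : ∑ p ∈ ⌊z⌋₊.primesLE, (p : ℝ)⁻¹ ≤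
      ∑ p ∈ ⌊z⌋₊.primesLE with ¬ p ∣ B, (p : ℝ)⁻¹ + ∑ p ∈ B.primeFactors, (p : ℝ)⁻¹ := by
    rw [← Finset.sum_filter_add_sum_filter_not ⌊z⌋₊.primesLE (fun p => ¬ p ∣ B)]
    apply add_le_add le_rfl
    apply Finset.sum_le_sum_of_subset_of_nonneg
    · intro p hp
      rw [Finset.mem_filter, not_not, Nat.mem_primesLE] at hp
      exact Nat.mem_primeFactors.2 ⟨hp.1.2, hp.2, hB0⟩
    · intros; positivity
  have h3 := sum_primeFactors_inv_le hB0 (by linarith : 0 < t)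
  have h4 := hC t ht
  have h5 : Real.log B / Real.log 2 / t ≤ 15 := by
    have hl2 := Real.log_two_gt_d9
    have h6 : Real.log B ≤ 10 * t := by
      have h7 : (0 : ℝ) < B := by exact_mod_cast Nat.pos_of_ne_zero hB0
      have h8 := Real.log_le_log h7 hB
      rw [Real.log_pow, Real.log_exp] at h8
      exact_mod_cast h8
    rw [div_div, div_le_iff₀ (by positivity)]
    nlinarith
  linarith

/-- The remainder of the sieve at level `exp (l / (338 L ^ 2))`, truncated at `13 L` primes, is
smaller than the smoothness bound `exp (l / (13 L))`. -/
theorem sieve_remainder_le {l L : ℝ} (hL : 0 < L) (hl : 26 * L * (29 * L + 1) ≤ l) {k r : ℕ}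
    (hk : (k : ℝ) ≤ 3) (hr : (r : ℝ) ≤ 13 * L) :
    Real.exp 1 * (3 * Real.exp (l / (338 * L ^ 2))) ^ r ≤
      Real.exp (l / (13 * L)) * Real.exp (-(k * L)) := by
  have hl0 : 0 ≤ l := le_trans (by positivity) hl
  have h3 : 3 * Real.exp (l / (338 * L ^ 2)) ≤ Real.exp (2 + l / (338 * L ^ 2)) := by
    rw [Real.exp_add]
    gcongr
    linarith [Real.add_one_le_exp (2 : ℝ)]
  calc Real.exp 1 * (3 * Real.exp (l / (338 * L ^ 2))) ^ r
      ≤ Real.exp 1 * Real.exp (2 + l / (338 * L ^ 2)) ^ r := by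
        gcongr
    _ = Real.exp (1 + r * (2 + l / (338 * L ^ 2))) := by
        rw [← Real.exp_nat_mul, ← Real.exp_add]
    _ ≤ Real.exp (l / (13 * L) + -(k * L)) := by
        apply Real.exp_le_exp.2
        have h4 : (r : ℝ) * (2 + l / (338 * L ^ 2)) ≤ 13 * L * (2 + l / (338 * L ^ 2)) := by
          gcongr
        have h5 : 13 * L * (2 + l / (338 * L ^ 2)) = 26 * L + l / (26 * L) := by
          field_simp; ring
        have h6 : l / (13 * L) = l / (26 * L) + l / (26 * L) := by field_simp; ring
        have h7 : 29 * L + 1 ≤ l / (26 * L) := by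
          rw [le_div_iff₀ (by positivity)]; linarith
        have h8 : (k : ℝ) * L ≤ 3 * L := by gcongr
        linarith
    _ = _ := by rw [Real.exp_add]

/-- Upper bound for the number of prime values of `k ≤ 3` linear forms, uniform in the coefficients
and losing only powers of `log log x`. The nonzero integer `B` collects the primes at which the
forms degenerate. -/
theorem exists_card_prime_values_le {k : ℕ} (hk : k ≤ 3) :
    ∃ C : ℝ, 0 < C ∧ ∀ᶠ x : ℝ in Filter.atTop, ∀ (N : ℝ) (a b : Fin k → ℤ) (B : ℕ) (S : Finset ℕ),
      0 ≤ N → B ≠ 0 → (B : ℝ) ≤ x ^ 10 →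
      (∀ p : ℕ, p.Prime → ¬ p ∣ B →
        (∀ i, ¬ (p : ℤ) ∣ a i) ∧ ∀ i j, i ≠ j → ¬ (p : ℤ) ∣ a i * b j - a j * b i) →
      (∀ n ∈ S, (n : ℝ) ≤ N ∧ smoothCutoff x < n ∧
        ∀ i, ∃ q : ℕ, q.Prime ∧ smoothCutoff x < q ∧ a i * n + b i = q) →
      (S.card : ℝ) ≤ C * N * Real.log (Real.log x) ^ (3 * k) / Real.log x ^ k := by
  obtain ⟨C₀, hC₀, hmertens⟩ := exists_sum_primes_inv_le
  set D : ℝ := 19 + C₀ + Real.log 338 with hD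
  refine ⟨Real.exp (k * D) + Real.exp (9 * C₀) + 1, by positivity, ?_⟩
  have hL : Filter.Tendsto (fun x : ℝ => Real.log (Real.log x)) Filter.atTop Filter.atTop :=
    Real.tendsto_log_atTop.comp Real.tendsto_log_atTop
  have hgrow : ∀ᶠ L : ℝ in Filter.atTop, 26 * L * (29 * L + 1) ≤ Real.exp L := by
    have h1 := (Real.tendsto_exp_div_pow_atTop 2).eventually_ge_atTop 780
    filter_upwards [h1, Filter.eventually_ge_atTop 1] with L h1 h2
    rw [le_div_iff₀ (by positivity)] at h1
    nlinarith
  filter_upwards [hL.eventually hgrow, hL.eventually_ge_atTop 3, Filter.eventually_gt_atTop 1]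
    with x hx1 hx2 hx3 N a b B S hN hB0 hB hgood hS
  set l := Real.log x with hl
  set L := Real.log l with hLdef
  have hl0 : 0 < l := Real.log_pos hx3
  have hL0 : 0 < L := by linarith
  have hexpL : Real.exp L = l := Real.exp_log hl0
  rw [hexpL] at hx1
  have hl338 : 338 * L ^ 2 ≤ l := by nlinarith
  rcases S.eq_empty_or_nonempty with rfl | ⟨n₀, hn₀⟩
  · simp; positivity
  have hyN : smoothCutoff x ≤ N := ((hS n₀ hn₀).2.1.le).trans (hS n₀ hn₀).1
  -- `338 = 2 * 13 * 13`: with `r ≤ 13 L` below, `z ^ r` is at most `√(smoothCutoff x)`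
  set z : ℝ := Real.exp (l / (338 * L ^ 2)) with hz
  have hlogz : Real.log z = l / (338 * L ^ 2) := Real.log_exp _
  have hlogz1 : 1 ≤ Real.log z := by rw [hlogz, one_le_div (by positivity)]; exact hl338
  have hz2 : 2 ≤ z := by
    have h1 : Real.exp 1 ≤ z := Real.exp_le_exp.2 (hlogz ▸ hlogz1)
    linarith [Real.add_one_le_exp (1 : ℝ)]
  have hzy : z ≤ smoothCutoff x := by
    apply Real.exp_le_exp.2
    apply div_le_div_of_nonneg_left hl0.le (by positivity)
    nlinarith
  have hloglogz : Real.log (Real.log z) = L - Real.log 338 - 2 * Real.log L := by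
    rw [hlogz, Real.log_div hl0.ne' (by positivity), Real.log_mul (by norm_num) (by positivity),
      Real.log_pow]
    push_cast; ring
  have hlogL : 0 ≤ Real.log L := Real.log_nonneg (by linarith)
  have hlog338 : 0 ≤ Real.log 338 := Real.log_nonneg (by norm_num)
  set P := ⌊z⌋₊.primesLE.filter (fun p => ¬ p ∣ B) with hP
  have hPmem : ∀ p ∈ P, p.Prime ∧ (p : ℝ) ≤ z ∧ ¬ p ∣ B := fun p hp => by
    rw [hP, Finset.mem_filter, Nat.mem_primesLE] at hp
    exact ⟨hp.1.2, (Nat.le_floor_iff (by linarith)).1 hp.1.1, hp.2⟩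
  have hcard : ∀ p ∈ P, (rootsMod a b p).card = k := fun p hp => by
    obtain ⟨h1, _, h3⟩ := hPmem p hp
    exact card_rootsMod h1 (hgood p h1 h3).1 (hgood p h1 h3).2
  -- `r ≥ 12 L` makes the tail `exp (-r) (log z) ^ (k e)` at most a constant times `(log x) ^ (-k)`,
  -- as `k e + k ≤ 3 e + 3 < 12`
  set r : ℕ := 2 * ⌈6 * L⌉₊ with hr
  have hr1 : 12 * L ≤ r := by
    have := Nat.le_ceil (6 * L)
    rw [hr]; push_cast; linarith
  have hr2 : (r : ℝ) ≤ 13 * L := by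
    have := Nat.ceil_lt_add_one (show 0 ≤ 6 * L by positivity)
    rw [hr]; push_cast; linarith
  have hk3 : (k : ℝ) ≤ 3 := by exact_mod_cast hk
  have hPcard : ∑ p ∈ P, ((rootsMod a b p).card : ℝ) ≤ 3 * z := by
    rw [Finset.sum_congr rfl (fun p hp => by rw [hcard p hp]), Finset.sum_const, nsmul_eq_mul]
    have h1 : (P.card : ℝ) ≤ z := by
      have h2 : P ⊆ Finset.Icc 1 ⌊z⌋₊ := fun p hp => by
        rw [Finset.mem_Icc]
        exact ⟨(hPmem p hp).1.pos, Nat.le_floor (hPmem p hp).2.1⟩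
      have h3 := Finset.card_le_card h2
      rw [Nat.card_Icc, Nat.add_sub_cancel] at h3
      exact (Nat.cast_le.2 h3).trans (Nat.floor_le (by linarith))
    nlinarith
  have hsub : S ⊆ (Finset.Ioc 0 ⌊N⌋₊).filter
      (fun n : ℕ => ∀ p ∈ P, (n : ZMod p) ∉ rootsMod a b p) := by
    intro n hn
    obtain ⟨h1, h2, h3⟩ := hS n hn
    have hn0 : (0 : ℝ) < n := (Real.exp_pos _).trans h2
    rw [Finset.mem_filter, Finset.mem_Ioc]
    refine ⟨⟨by exact_mod_cast hn0, Nat.le_floor h1⟩, fun p hp hmem => ?_⟩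
    obtain ⟨hp1, hp2, hp3⟩ := hPmem p hp
    obtain ⟨i, hi⟩ := dvd_of_mem_rootsMod hp1 (hgood p hp1 hp3).1 hmem
    obtain ⟨q, hq, hyq, hqe⟩ := h3 i
    rw [hqe] at hi
    have : p = q := (Nat.prime_dvd_prime_iff_eq hp1 hq).1 (by exact_mod_cast hi)
    subst this
    linarith
  have hsieve := card_sifted_le ⌊N⌋₊ (rootsMod a b) P (fun p hp => (hPmem p hp).1)
    (r := r) ⟨⌈6 * L⌉₊, by rw [hr]; ring⟩ (M := 3 * z) (by linarith) hPcard (fun p hp => by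
      have : NeZero p := ⟨(hPmem p hp).1.ne_zero⟩
      simpa [ZMod.card] using Finset.card_le_univ (rootsMod a b p))
  have hsum : ∑ p ∈ P, ((rootsMod a b p).card : ℝ) / p = k * ∑ p ∈ P, (p : ℝ)⁻¹ := by
    rw [Finset.mul_sum]
    exact Finset.sum_congr rfl fun p hp => by rw [hcard p hp, div_eq_mul_inv]
  rw [hsum] at hsieve
  -- the sum over the sieving primes
  have hup : ∑ p ∈ P, (p : ℝ)⁻¹ ≤ L + C₀ := by
    calc ∑ p ∈ P, (p : ℝ)⁻¹ ≤ ∑ p ∈ ⌊z⌋₊.primesLE, (p : ℝ)⁻¹ :=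
          Finset.sum_le_sum_of_subset_of_nonneg (Finset.filter_subset _ _)
            fun _ _ _ => by positivity
      _ ≤ Real.log (Real.log z) + C₀ := hmertens z hz2
      _ ≤ L + C₀ := by rw [hloglogz]; linarith
  have hlow : L - 3 * Real.log L - D ≤ ∑ p ∈ P, (p : ℝ)⁻¹ := by
    have h1 := log_log_sub_le_sum_primes_not_dvd hmertens (z := z) (t := l) (by linarith) hB0
      (by nlinarith)
      (by rw [hl, Real.exp_log (by linarith)]; exact hB)
    rw [hloglogz] at h1
    rw [← hLdef] at h1
    linarith
  have hlk : Real.exp (-(k * L)) = (l ^ k)⁻¹ := by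
    rw [Real.exp_neg, Real.exp_nat_mul, hexpL]
  have hLk : Real.exp (k * (3 * Real.log L)) = L ^ (3 * k) := by
    rw [show (k : ℝ) * (3 * Real.log L) = ((3 * k : ℕ) : ℝ) * Real.log L by push_cast; ring,
      Real.exp_nat_mul, Real.exp_log hL0]
  have hLk1 : 1 ≤ L ^ (3 * k) := one_le_pow₀ (by linarith)
  have t1 : Real.exp (-(k * ∑ p ∈ P, (p : ℝ)⁻¹)) ≤
      Real.exp (k * D) * (L ^ (3 * k) * (l ^ k)⁻¹) := by
    rw [← hlk, ← hLk, ← Real.exp_add, ← Real.exp_add]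
    apply Real.exp_le_exp.2
    have := mul_le_mul_of_nonneg_left hlow (Nat.cast_nonneg k : (0 : ℝ) ≤ k)
    linarith
  have he3 := Real.exp_one_lt_d9
  have he0 := Real.exp_pos 1
  have t2 : Real.exp (-r) * Real.exp (Real.exp 1 * (k * ∑ p ∈ P, (p : ℝ)⁻¹)) ≤
      Real.exp (9 * C₀) * (L ^ (3 * k) * (l ^ k)⁻¹) := by
    have h1 : Real.exp (-r) * Real.exp (Real.exp 1 * (k * ∑ p ∈ P, (p : ℝ)⁻¹)) ≤
        Real.exp (9 * C₀) * Real.exp (-(k * L)) := by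
      rw [← Real.exp_add, ← Real.exp_add]
      apply Real.exp_le_exp.2
      have h2 : Real.exp 1 * (k * ∑ p ∈ P, (p : ℝ)⁻¹) ≤ 2.72 * (3 * (L + C₀)) := by
        have h0 : 0 ≤ ∑ p ∈ P, (p : ℝ)⁻¹ := Finset.sum_nonneg fun _ _ => by positivity
        have h3 : (k : ℝ) * ∑ p ∈ P, (p : ℝ)⁻¹ ≤ 3 * (L + C₀) :=
          mul_le_mul hk3 hup h0 (by norm_num)
        exact mul_le_mul (by linarith) h3 (by positivity) (by norm_num)
      have h4 : (k : ℝ) * L ≤ 3 * L := by gcongr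
      linarith
    refine h1.trans ?_
    rw [hlk]
    have : (l ^ k)⁻¹ ≤ L ^ (3 * k) * (l ^ k)⁻¹ := le_mul_of_one_le_left (by positivity) hLk1
    gcongr
  have t3 : Real.exp 1 * (3 * z) ^ r ≤ N * (L ^ (3 * k) * (l ^ k)⁻¹) := by
    have h1 : Real.exp 1 * (3 * z) ^ r ≤ smoothCutoff x * Real.exp (-(k * L)) :=
      sieve_remainder_le hL0 hx1 hk3 hr2
    refine h1.trans ?_
    rw [hlk]
    have : (l ^ k)⁻¹ ≤ L ^ (3 * k) * (l ^ k)⁻¹ := le_mul_of_one_le_left (by positivity) hLk1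
    exact mul_le_mul hyN this (by positivity) hN
  have hfloor : (⌊N⌋₊ : ℝ) ≤ N := Nat.floor_le hN
  calc (S.card : ℝ) ≤ _ := by exact_mod_cast Finset.card_le_card hsub
    _ ≤ _ := hsieve
    _ ≤ N * (Real.exp (k * D) * (L ^ (3 * k) * (l ^ k)⁻¹) +
          Real.exp (9 * C₀) * (L ^ (3 * k) * (l ^ k)⁻¹)) + N * (L ^ (3 * k) * (l ^ k)⁻¹) := by
        gcongr
    _ = _ := by rw [div_eq_mul_inv]; ring

/-! ### Shifted primes with many or few prime factors -/

open ArithmeticFunction in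
/-- Primes `p ≤ x` such that `p - 1 = m P` with `P` a large prime and `Ω(m) ≥ K - 1` (Rankin's trick
with weight `w ^ Ω(m)`, `w ≥ 1`). -/
theorem exists_card_primes_many_factors_le {w : ℝ} (hw1 : 1 ≤ w) (hw2 : w < 2) :
    ∃ C : ℝ, 0 < C ∧ ∀ᶠ x : ℝ in Filter.atTop, ∀ (K : ℝ) (S : Finset ℕ),
      (∀ p ∈ S, p.Prime ∧ (p : ℝ) ≤ x ∧ ∃ m P : ℕ, m ≠ 0 ∧ P.Prime ∧ smoothCutoff x < P ∧
        p = m * P + 1 ∧ K ≤ cardFactors m + 1) →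
      (S.card : ℝ) ≤
        C * x * w ^ (-K) * Real.log (Real.log x) ^ 6 / Real.log x ^ 2 * Real.log x ^ w := by
  obtain ⟨C₁, hC₁, h1⟩ := exists_card_prime_values_le (k := 2) (by norm_num)
  obtain ⟨C₂, hC₂, h2⟩ := exists_sum_pow_cardFactors_div_le (by linarith) hw2
  refine ⟨C₁ * w * C₂, by positivity, ?_⟩
  filter_upwards [h1, Filter.eventually_ge_atTop 3] with x h1 hx3 K S hS
  have hl0 : 0 < Real.log x := Real.log_pos (by linarith)
  set l := Real.log x
  set L := Real.log l
  set X := ⌊x⌋₊ with hX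
  set I := (Finset.Icc 1 X).filter (fun m => K ≤ cardFactors m + 1) with hI
  set T : ℕ → Finset ℕ := fun m => (Finset.Icc 1 X).filter
    (fun P => P.Prime ∧ smoothCutoff x < P ∧ (m * P + 1) ∈ S) with hT
  have hsub : S ⊆ I.biUnion fun m => (T m).image fun P => m * P + 1 := by
    intro p hp
    obtain ⟨h3, h4, m, P, hm, hP, hyP, rfl, hK⟩ := hS p hp
    have h5 : m * P + 1 ≤ X := Nat.le_floor h4
    have hP0 := hP.pos
    have hm0 : 1 ≤ m := Nat.one_le_iff_ne_zero.2 hm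
    have h6 : m ≤ m * P := Nat.le_mul_of_pos_right m hP0
    have h7 : P ≤ m * P := Nat.le_mul_of_pos_left P hm0
    simp only [Finset.mem_biUnion, Finset.mem_image, hI, hT, Finset.mem_filter, Finset.mem_Icc]
    exact ⟨m, ⟨⟨hm0, by omega⟩, hK⟩, P, ⟨⟨hP0, by omega⟩, hP, hyP, hp⟩, rfl⟩
  have hTm : ∀ m ∈ I, ((T m).card : ℝ) ≤ C₁ * (x / m) * L ^ 6 / l ^ 2 := by
    intro m hm
    rw [hI, Finset.mem_filter, Finset.mem_Icc] at hm
    have hm0 : (0 : ℝ) < m := by exact_mod_cast hm.1.1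
    have hmx : (m : ℝ) ≤ x := (Nat.le_floor_iff (by linarith)).1 hm.1.2
    refine h1 (x / m) ![1, (m : ℤ)] ![0, 1] m (T m) (by positivity) (by omega)
      (hmx.trans (le_self_pow₀ (by linarith) (by norm_num))) ?_ ?_
    · intro p hp hpm
      have hp1 : ¬ (p : ℤ) ∣ 1 := by
        intro h; exact hp.one_lt.ne' (by exact_mod_cast Int.eq_one_of_dvd_one (by positivity) h)
      have hpm' : ¬ (p : ℤ) ∣ m := by exact_mod_cast hpm
      refine ⟨fun i => ?_, fun i j hij => ?_⟩
      · fin_cases i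
        · simpa using hp1
        · simpa using hpm'
      · fin_cases i <;> fin_cases j <;> simp at hij ⊢ <;> simpa using hp1
    · intro P hP
      simp only [hT, Finset.mem_filter, Finset.mem_Icc] at hP
      obtain ⟨⟨_, _⟩, hP, hyP, hmem⟩ := hP
      obtain ⟨hq, hqx, _⟩ := hS _ hmem
      push_cast at hqx
      refine ⟨by rw [le_div_iff₀ hm0]; linarith, hyP, fun i => ?_⟩
      fin_cases i
      · exact ⟨P, hP, hyP, by simp⟩
      · refine ⟨m * P + 1, hq, ?_, by simp⟩
        have : (1 : ℝ) ≤ m := by exact_mod_cast hm.1.1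
        have : (P : ℝ) ≤ m * P := le_mul_of_one_le_left (by positivity) this
        push_cast; linarith
  calc (S.card : ℝ) ≤ ∑ m ∈ I, ((T m).card : ℝ) := by
        have h3 := (Finset.card_le_card hsub).trans Finset.card_biUnion_le
        have h4 : ∑ m ∈ I, ((T m).image fun P => m * P + 1).card ≤ ∑ m ∈ I, (T m).card :=
          Finset.sum_le_sum fun m _ => Finset.card_image_le
        exact_mod_cast h3.trans h4
    _ ≤ ∑ m ∈ I, C₁ * (x / m) * L ^ 6 / l ^ 2 * (w ^ (-K) * w ^ (cardFactors m + 1)) := by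
        refine Finset.sum_le_sum fun m hm => (hTm m hm).trans ?_
        rw [hI, Finset.mem_filter] at hm
        apply le_mul_of_one_le_right (by positivity)
        rw [← Real.rpow_natCast, ← Real.rpow_add (by linarith)]
        apply Real.one_le_rpow hw1
        push_cast; linarith [hm.2]
    _ ≤ ∑ m ∈ Finset.Icc 1 X, C₁ * (x / m) * L ^ 6 / l ^ 2 *
          (w ^ (-K) * w ^ (cardFactors m + 1)) := by
        refine Finset.sum_le_sum_of_subset_of_nonneg (Finset.filter_subset _ _) fun m _ _ => ?_
        positivity
    _ = C₁ * w * x * w ^ (-K) * L ^ 6 / l ^ 2 *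
          ∑ m ∈ Finset.Icc 1 X, w ^ cardFactors m / (m : ℝ) := by
        rw [Finset.mul_sum]
        refine Finset.sum_congr rfl fun m _ => ?_
        rw [pow_succ]; ring
    _ ≤ C₁ * w * x * w ^ (-K) * L ^ 6 / l ^ 2 * (C₂ * l ^ w) := by
        gcongr
        exact h2 x (by linarith)
    _ = _ := by ring

open ArithmeticFunction in
/-- Primes `p ≤ x` such that `p - 1 = u v P` with `P` a large prime and `Ω(u v) ≤ K - 1`, and such
that `β P + γ` is also prime (Rankin's trick with weight `w ^ Ω(u v)`, `w ≤ 1`). The coefficients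
`β`, `γ` may depend on `u` and `v`, and `δ` is an integer such that the forms `P`, `u v P + 1`,
`β P + γ` degenerate only at primes dividing `u v δ`. -/
theorem exists_card_prime_pairs_few_factors_le {w : ℝ} (hw0 : 0 < w) (hw1 : w ≤ 1) :
    ∃ C : ℝ, 0 < C ∧ ∀ᶠ x : ℝ in Filter.atTop, ∀ (K : ℝ) (β γ δ : ℕ → ℕ → ℤ) (S : Finset ℕ),
      (∀ u v : ℕ, u ≠ 0 → v ≠ 0 → |δ u v| ≤ u + v) →
      (∀ u v p : ℕ, p.Prime → ¬ (p : ℤ) ∣ u → ¬ (p : ℤ) ∣ v → ¬ (p : ℤ) ∣ δ u v →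
        ¬ (p : ℤ) ∣ β u v ∧ ¬ (p : ℤ) ∣ γ u v ∧ ¬ (p : ℤ) ∣ u * v * γ u v - β u v) →
      (∀ p ∈ S, p.Prime ∧ (p : ℝ) ≤ x ∧ ∃ u v P q : ℕ, u ≠ 0 ∧ v ≠ 0 ∧ δ u v ≠ 0 ∧
        P.Prime ∧ smoothCutoff x < P ∧ p = u * v * P + 1 ∧
        q.Prime ∧ P ≤ q ∧ β u v * P + γ u v = q ∧
        (cardFactors u + cardFactors v + 1 : ℝ) ≤ K) →
      (S.card : ℝ) ≤
        C * x * w ^ (-K) * Real.log (Real.log x) ^ 9 / Real.log x ^ 3 * (Real.log x ^ w) ^ 2 := by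
  classical
  obtain ⟨C₁, hC₁, h1⟩ := exists_card_prime_values_le (k := 3) le_rfl
  obtain ⟨C₂, hC₂, h2⟩ := exists_sum_pow_cardFactors_div_le hw0.le (by linarith)
  refine ⟨C₁ * w * C₂ ^ 2, by positivity, ?_⟩
  have hL : Filter.Tendsto (fun x : ℝ => Real.log (Real.log x)) Filter.atTop Filter.atTop :=
    Real.tendsto_log_atTop.comp Real.tendsto_log_atTop
  filter_upwards [h1, Filter.eventually_ge_atTop 3, hL.eventually_ge_atTop 0]
    with x h1 hx3 hL0 K β γ δ S hδ hgood hS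
  have hl0 : 0 < Real.log x := Real.log_pos (by linarith)
  set l := Real.log x
  set L := Real.log l
  set X := ⌊x⌋₊ with hX
  set I := (Finset.Icc 1 X ×ˢ Finset.Icc 1 X).filter
    (fun m => (cardFactors m.1 + cardFactors m.2 + 1 : ℝ) ≤ K ∧ δ m.1 m.2 ≠ 0) with hI
  set T : ℕ × ℕ → Finset ℕ := fun m => (Finset.Icc 1 X).filter
    (fun P => P.Prime ∧ smoothCutoff x < P ∧ (m.1 * m.2 * P + 1) ∈ S ∧
      ∃ q : ℕ, q.Prime ∧ P ≤ q ∧ β m.1 m.2 * P + γ m.1 m.2 = q) with hT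
  have hsub : S ⊆ I.biUnion fun m => (T m).image fun P => m.1 * m.2 * P + 1 := by
    intro p hp
    obtain ⟨h3, h4, u, v, P, q, hu, hv, hδ0, hP, hyP, rfl, hq, hPq, hqe, hK⟩ := hS p hp
    have h5 : u * v * P + 1 ≤ X := Nat.le_floor h4
    have hP0 := hP.pos
    have hu0 : 1 ≤ u := Nat.one_le_iff_ne_zero.2 hu
    have hv0 : 1 ≤ v := Nat.one_le_iff_ne_zero.2 hv
    have h6 : u * v ≤ u * v * P := Nat.le_mul_of_pos_right _ hP0
    have h7 : P ≤ u * v * P := Nat.le_mul_of_pos_left P (Nat.mul_pos hu0 hv0)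
    have h8 : u ≤ u * v := Nat.le_mul_of_pos_right _ hv0
    have h9 : v ≤ u * v := Nat.le_mul_of_pos_left _ hu0
    simp only [Finset.mem_biUnion, Finset.mem_image, hI, hT, Finset.mem_filter, Finset.mem_Icc,
      Finset.mem_product]
    exact ⟨(u, v), ⟨⟨⟨hu0, by omega⟩, ⟨hv0, by omega⟩⟩, hK, hδ0⟩, P,
      ⟨⟨hP0, by omega⟩, hP, hyP, hp, q, hq, hPq, hqe⟩, rfl⟩
  have hTm : ∀ m ∈ I, ((T m).card : ℝ) ≤ C₁ * (x / (m.1 * m.2)) * L ^ 9 / l ^ 3 := by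
    rintro ⟨u, v⟩ hm
    simp only [hI, Finset.mem_filter, Finset.mem_product, Finset.mem_Icc] at hm
    obtain ⟨⟨⟨hu1, huX⟩, ⟨hv1, hvX⟩⟩, hK, hδ0⟩ := hm
    have hu0 : (1 : ℝ) ≤ u := by exact_mod_cast hu1
    have hv0 : (1 : ℝ) ≤ v := by exact_mod_cast hv1
    have hux : (u : ℝ) ≤ x := (Nat.le_floor_iff (by linarith)).1 huX
    have hvx : (v : ℝ) ≤ x := (Nat.le_floor_iff (by linarith)).1 hvX
    have huv : (1 : ℝ) ≤ u * v := one_le_mul_of_one_le_of_one_le hu0 hv0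
    have hδx : (((δ u v).natAbs : ℕ) : ℝ) ≤ 2 * x := by
      have h3 : (((δ u v).natAbs : ℕ) : ℤ) ≤ u + v := by
        rw [Int.natCast_natAbs]; exact hδ u v (by omega) (by omega)
      have h4 : (((δ u v).natAbs : ℕ) : ℝ) ≤ u + v := by exact_mod_cast h3
      linarith
    refine h1 (x / (u * v)) ![1, (u * v : ℤ), β u v] ![0, 1, γ u v] (u * v * (δ u v).natAbs)
      (T (u, v)) (by positivity) ?_ ?_ ?_ ?_
    · exact Nat.mul_ne_zero (Nat.mul_ne_zero (by omega) (by omega)) (Int.natAbs_ne_zero.2 hδ0)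
    · push_cast
      calc (u : ℝ) * v * ((δ u v).natAbs : ℕ) ≤ x * x * (2 * x) := by gcongr
        _ ≤ x * x * (x * x) := by gcongr; linarith
        _ = x ^ 4 := by ring
        _ ≤ x ^ 10 := pow_le_pow_right₀ (by linarith) (by norm_num)
    · intro p hp hpB
      have hp' := Nat.prime_iff_prime_int.1 hp
      have hp1 : ¬ (p : ℤ) ∣ 1 := hp'.not_dvd_one
      have hpu : ¬ (p : ℤ) ∣ u := fun h => hpB
        (((Int.natCast_dvd_natCast.1 h).mul_right v).mul_right _)
      have hpv : ¬ (p : ℤ) ∣ v := fun h => hpB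
        (((Int.natCast_dvd_natCast.1 h).mul_left u).mul_right _)
      have hpδ : ¬ (p : ℤ) ∣ δ u v := fun h => hpB
        ((Int.natCast_dvd.1 h).mul_left _)
      have hpuv : ¬ (p : ℤ) ∣ (u * v : ℤ) := fun h => (hp'.dvd_or_dvd h).elim hpu hpv
      obtain ⟨g1, g2, g3⟩ := hgood u v p hp hpu hpv hpδ
      have g3' : ¬ (p : ℤ) ∣ β u v - u * v * γ u v := by rwa [dvd_sub_comm]
      refine ⟨fun i => ?_, fun i j hij => ?_⟩
      · fin_cases i
        · simpa using hp1
        · simpa using hpuv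
        · simpa using g1
      · fin_cases i <;> fin_cases j <;> simp at hij ⊢ <;>
          first
          | simpa using hp1
          | simpa using g2
          | simpa using g3
          | simpa using g3'
    · intro P hP
      simp only [hT, Finset.mem_filter, Finset.mem_Icc] at hP
      obtain ⟨⟨_, _⟩, hP, hyP, hmem, q, hq, hPq, hqe⟩ := hP
      obtain ⟨hp, hpx, _⟩ := hS _ hmem
      push_cast at hpx
      refine ⟨by rw [le_div_iff₀ (by linarith)]; linarith, hyP, fun i => ?_⟩
      fin_cases i
      · exact ⟨P, hP, hyP, by simp⟩
      · refine ⟨u * v * P + 1, hp, ?_, by simp⟩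
        have : (P : ℝ) ≤ u * v * P := le_mul_of_one_le_left (by positivity) huv
        push_cast; linarith
      · have : (P : ℝ) ≤ q := by exact_mod_cast hPq
        exact ⟨q, hq, by linarith, by simpa using hqe⟩
  calc (S.card : ℝ) ≤ ∑ m ∈ I, ((T m).card : ℝ) := by
        have h3 := (Finset.card_le_card hsub).trans Finset.card_biUnion_le
        have h4 : ∑ m ∈ I, ((T m).image fun P => m.1 * m.2 * P + 1).card ≤ ∑ m ∈ I, (T m).card :=
          Finset.sum_le_sum fun m _ => Finset.card_image_le
        exact_mod_cast h3.trans h4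
    _ ≤ ∑ m ∈ I, C₁ * (x / (m.1 * m.2)) * L ^ 9 / l ^ 3 *
          (w ^ (-K) * w ^ (cardFactors m.1 + cardFactors m.2 + 1)) := by
        refine Finset.sum_le_sum fun m hm => (hTm m hm).trans ?_
        rw [hI, Finset.mem_filter] at hm
        apply le_mul_of_one_le_right (by positivity)
        rw [← Real.rpow_natCast, ← Real.rpow_add hw0]
        apply Real.one_le_rpow_of_pos_of_le_one_of_nonpos hw0 hw1
        push_cast; linarith [hm.2.1]
    _ ≤ ∑ m ∈ Finset.Icc 1 X ×ˢ Finset.Icc 1 X, C₁ * (x / (m.1 * m.2)) * L ^ 9 / l ^ 3 *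
          (w ^ (-K) * w ^ (cardFactors m.1 + cardFactors m.2 + 1)) := by
        refine Finset.sum_le_sum_of_subset_of_nonneg (Finset.filter_subset _ _) fun m _ _ => ?_
        positivity
    _ = C₁ * w * x * w ^ (-K) * L ^ 9 / l ^ 3 *
          (∑ m ∈ Finset.Icc 1 X, w ^ cardFactors m / (m : ℝ)) ^ 2 := by
        rw [pow_two (∑ m ∈ Finset.Icc 1 X, w ^ cardFactors m / (m : ℝ)), Finset.sum_mul_sum,
          ← Finset.sum_product', Finset.mul_sum]
        refine Finset.sum_congr rfl fun m _ => ?_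
        rw [pow_succ, pow_add, ← div_div]; ring
    _ ≤ C₁ * w * x * w ^ (-K) * L ^ 9 / l ^ 3 * (C₂ * l ^ w) ^ 2 := by
        gcongr
        exact h2 x (by linarith)
    _ = _ := by ring

/-! ### Symmetric primes -/

/-- This makes a bound `x (log x) ^ (-2)` for the smooth case acceptable. -/
theorem symmetricEta_le_one : symmetricEta ≤ 1 := by
  have h2 : 0 < Real.log 2 := Real.log_pos (by norm_num)
  have h3 : -1 ≤ Real.log (Real.log 2) := by
    rw [Real.le_log_iff_exp_le h2, Real.exp_neg, inv_le_comm₀ (Real.exp_pos 1) h2]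
    have := Real.exp_one_gt_d9
    have : (Real.log 2)⁻¹ ≤ 2 := by
      rw [inv_le_comm₀ h2 (by norm_num)]; linarith [Real.log_two_gt_d9]
    linarith
  have : 0 ≤ (1 + Real.log (Real.log 2)) / Real.log 2 := div_nonneg (by linarith) h2.le
  rw [symmetricEta]; linarith

/-- The partner of a symmetric prime `p` is `p + s d` with `s = ±1` and `d` a divisor of `p - 1`. -/
theorem IsSymmetricPair.exists_eq {p q : ℕ} (h : IsSymmetricPair p q) :
    ∃ (a d : ℕ) (s : ℤ), a ≠ 0 ∧ 2 ≤ d ∧ (s = 1 ∨ s = -1) ∧ p = a * d + 1 ∧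
      (q : ℤ) = (a + s) * d + 1 := by
  obtain ⟨hp, hq, hpo, hqo, hne, hg⟩ := h
  set d := Nat.gcd (p - 1) (q - 1) with hd
  obtain ⟨a, ha⟩ : d ∣ p - 1 := Nat.gcd_dvd_left _ _
  have hp1 := hp.two_le
  have ha' : p = a * d + 1 := by rw [mul_comm] at ha; omega
  have hd2 : 2 ≤ d := by
    obtain ⟨i, hi⟩ := hpo
    obtain ⟨j, hj⟩ := hqo
    have h1 : (2 : ℤ) ∣ |(p : ℤ) - q| := by
      rw [dvd_abs]; exact ⟨i - j, by rw [hi, hj]; push_cast; ring⟩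
    have h2 : 0 < |(p : ℤ) - q| := abs_pos.2 (sub_ne_zero.2 (by exact_mod_cast hne))
    have := Int.le_of_dvd h2 h1
    omega
  have ha0 : a ≠ 0 := by
    rintro rfl; omega
  have hpz : (p : ℤ) = a * d + 1 := by exact_mod_cast ha'
  rcases abs_choice ((p : ℤ) - q) with h | h
  · refine ⟨a, d, -1, ha0, hd2, Or.inr rfl, ha', ?_⟩
    rw [h] at hg; linarith
  · refine ⟨a, d, 1, ha0, hd2, Or.inl rfl, ha', ?_⟩
    rw [h] at hg; linarith

/-- If `a d` is not `Y`-smooth, a prime above `Y` can be split off one of the factors. -/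
theorem exists_large_prime_factor {a d Y : ℕ} (ha : a ≠ 0) (hd : d ≠ 0)
    (h : a * d ∉ (Y + 1).smoothNumbers) :
    ∃ e P : ℕ, e ≠ 0 ∧ P.Prime ∧ Y < P ∧ (d = e * P ∨ a = e * P) := by
  rw [Nat.mem_smoothNumbers'] at h
  push Not at h
  obtain ⟨P, hP, hdvd, hle⟩ := h
  rcases (Nat.Prime.dvd_mul hP).1 hdvd with ⟨e, he⟩ | ⟨e, he⟩
  · exact ⟨e, P, by rintro rfl; simp at he; exact ha he, hP, by omega, Or.inr (by rw [he]; ring)⟩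
  · exact ⟨e, P, by rintro rfl; simp at he; exact hd he, hP, by omega, Or.inl (by rw [he]; ring)⟩

/-- `S(x)` split according to whether `p - 1` is smooth, has many prime factors, or has few. -/
theorem exists_symmetricPrimeCount_le {κ : ℝ} (hκ1 : 1 ≤ κ) (hκ2 : κ < 2) :
    ∃ C : ℝ, 0 < C ∧ ∀ᶠ x : ℝ in Filter.atTop,
      (symmetricPrimeCount x : ℝ) ≤ C * x * (
        Real.exp (-(13 * Real.log (Real.log x))) * Real.log x ^ 11 +
        κ ^ (-(κ * Real.log (Real.log x))) * Real.log (Real.log x) ^ 6 / Real.log x ^ 2 *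
          Real.log x ^ κ +
        (κ / 2) ^ (-(κ * Real.log (Real.log x))) * Real.log (Real.log x) ^ 9 / Real.log x ^ 3 *
          (Real.log x ^ (κ / 2)) ^ 2) := by
  classical
  obtain ⟨C₀, hC₀, h0⟩ := exists_card_smoothNumbers_le
  obtain ⟨C₁, hC₁, h1⟩ := exists_card_primes_many_factors_le hκ1 hκ2
  obtain ⟨C₂, hC₂, h2⟩ := exists_card_prime_pairs_few_factors_le (w := κ / 2)
    (by linarith) (by linarith)
  refine ⟨C₀ + C₁ + 4 * C₂, by positivity, ?_⟩
  have hL : Filter.Tendsto (fun x : ℝ => Real.log (Real.log x)) Filter.atTop Filter.atTop :=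
    Real.tendsto_log_atTop.comp Real.tendsto_log_atTop
  have hbig : ∀ᶠ L : ℝ in Filter.atTop, 39 * L ≤ Real.exp L := by
    have h1 := (Real.tendsto_exp_div_pow_atTop 1).eventually_ge_atTop 39
    filter_upwards [h1, Filter.eventually_gt_atTop 0] with L h1 h2
    rw [le_div_iff₀ (by positivity)] at h1
    simpa using h1
  filter_upwards [h1, h2, Filter.eventually_ge_atTop 3, hL.eventually_ge_atTop 1,
    hL.eventually hbig] with x h1 h2 hx3 hL1 hLe
  have hl0 : 0 < Real.log x := Real.log_pos (by linarith)
  rw [Real.exp_log hl0] at hLe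
  have hlogy : Real.log (smoothCutoff x) = Real.log x / (13 * Real.log (Real.log x)) :=
    Real.log_exp _
  set l := Real.log x with hl
  set L := Real.log l with hLdef
  set y := smoothCutoff x with hy
  set Y := ⌊y⌋₊ with hY
  set X := ⌊x⌋₊ with hX
  have hlogy3 : 3 ≤ Real.log y := by rw [hlogy, le_div_iff₀ (by positivity)]; linarith
  have hy8 : 8 ≤ y := by
    rw [Real.le_log_iff_exp_le (show 0 < y from Real.exp_pos _)] at hlogy3
    refine le_trans ?_ hlogy3
    have := Real.exp_one_gt_d9
    have e : Real.exp 3 = Real.exp 1 ^ 3 := by rw [← Real.exp_nat_mul]; norm_num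
    rw [e]
    calc (8 : ℝ) = 2 ^ 3 := by norm_num
      _ ≤ _ := by gcongr; linarith
  set U := (Finset.Icc 1 X).filter IsSymmetricPrime with hU
  have hcount : symmetricPrimeCount x = U.card := by
    rw [symmetricPrimeCount, ← Set.ncard_coe_finset]
    congr 1
    ext p
    simp only [hU, Set.mem_ofPred_eq, Finset.coe_filter, Finset.mem_Icc]
    constructor
    · rintro ⟨h3, h4⟩
      obtain ⟨q, hq⟩ := id h4
      exact ⟨⟨hq.1.one_le, Nat.le_floor h3⟩, h4⟩
    · rintro ⟨⟨_, h3⟩, h4⟩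
      exact ⟨(Nat.le_floor_iff (by linarith)).1 h3, h4⟩
  set K := κ * L with hK
  -- `p - 1` smooth
  set S₀ := (Finset.Icc 1 X).filter (fun m => m ∈ (Y + 1).smoothNumbers) with hS₀
  -- `p - 1 = m P` with many prime factors
  set S₁ := (Finset.Icc 1 X).filter (fun p => p.Prime ∧ ∃ m P : ℕ, m ≠ 0 ∧ P.Prime ∧ y < P ∧
    p = m * P + 1 ∧ K ≤ ArithmeticFunction.cardFactors m + 1) with hS₁
  -- `p - 1 = u v P` with few prime factors, where `β P + γ` is prime
  let S₂ : (ℕ → ℕ → ℤ) → (ℕ → ℕ → ℤ) → (ℕ → ℕ → ℤ) → Finset ℕ := fun β γ δ =>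
    (Finset.Icc 1 X).filter (fun p => p.Prime ∧ ∃ u v P q : ℕ, u ≠ 0 ∧ v ≠ 0 ∧ δ u v ≠ 0 ∧
        P.Prime ∧ y < P ∧ p = u * v * P + 1 ∧
        q.Prime ∧ P ≤ q ∧ β u v * P + γ u v = q ∧
        (ArithmeticFunction.cardFactors u + ArithmeticFunction.cardFactors v + 1 : ℝ) ≤ K)
  -- `P ∣ d`: here `u = a`, `d = v P`, and the partner is `(u + s) v P + 1`
  let V : ℤ → Finset ℕ := fun s =>
    S₂ (fun u v => (u + s) * v) (fun _ _ => 1) (fun u _ => u + s)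
  -- `P ∣ a`: here `u = d`, `a = v P`, and the partner is `u v P + 1 + s u`
  let W : ℤ → Finset ℕ := fun s =>
    S₂ (fun u v => u * v) (fun u _ => 1 + s * u) (fun u _ => 1 + s * u)
  have hxmem : ∀ p ∈ Finset.Icc 1 X, (p : ℝ) ≤ x := fun p hp =>
    (Nat.le_floor_iff (by linarith)).1 (Finset.mem_Icc.1 hp).2
  have hS₂card : ∀ β γ δ : ℕ → ℕ → ℤ,
      (∀ u v : ℕ, u ≠ 0 → v ≠ 0 → |δ u v| ≤ u + v) →
      (∀ u v p : ℕ, p.Prime → ¬ (p : ℤ) ∣ u → ¬ (p : ℤ) ∣ v → ¬ (p : ℤ) ∣ δ u v →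
        ¬ (p : ℤ) ∣ β u v ∧ ¬ (p : ℤ) ∣ γ u v ∧ ¬ (p : ℤ) ∣ u * v * γ u v - β u v) →
      ((S₂ β γ δ).card : ℝ) ≤ C₂ * x * (κ / 2) ^ (-K) * L ^ 9 / l ^ 3 * (l ^ (κ / 2)) ^ 2 := by
    intro β γ δ hδ hgood
    refine h2 K β γ δ _ hδ hgood fun p hp => ?_
    obtain ⟨h3, h4, h5⟩ := Finset.mem_filter.1 hp
    exact ⟨h4, hxmem p h3, h5⟩
  have hunit : ∀ s : ℤ, s = 1 ∨ s = -1 → |s| = 1 := by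
    rintro s (rfl | rfl) <;> simp
  have hsdvd : ∀ s : ℤ, s = 1 ∨ s = -1 → ∀ p : ℕ, p.Prime → ¬ (p : ℤ) ∣ s := by
    rintro s (rfl | rfl) p hp h
    · exact (Nat.prime_iff_prime_int.1 hp).not_dvd_one h
    · exact (Nat.prime_iff_prime_int.1 hp).not_dvd_one (by simpa using h)
  have hVcard : ∀ s : ℤ, s = 1 ∨ s = -1 →
      ((V s).card : ℝ) ≤ C₂ * x * (κ / 2) ^ (-K) * L ^ 9 / l ^ 3 * (l ^ (κ / 2)) ^ 2 := by
    intro s hs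
    refine hS₂card _ _ _ (fun u v _ hv => ?_) fun u v p hp hpu hpv hpδ => ?_
    · have h3 := abs_add_le (u : ℤ) s
      rw [hunit s hs] at h3
      have h4 : |(u : ℤ)| = u := abs_of_nonneg (by positivity)
      have : (1 : ℤ) ≤ v := by omega
      linarith
    · have hp' := Nat.prime_iff_prime_int.1 hp
      refine ⟨fun h => (hp'.dvd_or_dvd h).elim hpδ hpv, hp'.not_dvd_one, fun h => ?_⟩
      have e : (u * v * 1 - (u + s) * v : ℤ) = -(s * v) := by ring
      rw [e, dvd_neg] at h
      exact (hp'.dvd_or_dvd h).elim (hsdvd s hs p hp) hpv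
  have hWcard : ∀ s : ℤ, s = 1 ∨ s = -1 →
      ((W s).card : ℝ) ≤ C₂ * x * (κ / 2) ^ (-K) * L ^ 9 / l ^ 3 * (l ^ (κ / 2)) ^ 2 := by
    intro s hs
    refine hS₂card _ _ _ (fun u v _ hv => ?_) fun u v p hp hpu hpv hpδ => ?_
    · have h3 := abs_add_le 1 (s * u)
      rw [abs_mul, hunit s hs, abs_one, one_mul] at h3
      have h4 : |(u : ℤ)| = u := abs_of_nonneg (by positivity)
      have : (1 : ℤ) ≤ v := by omega
      linarith
    · have hp' := Nat.prime_iff_prime_int.1 hp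
      refine ⟨fun h => (hp'.dvd_or_dvd h).elim hpu hpv, hpδ, fun h => ?_⟩
      have e : (u * v * (1 + s * u) - u * v : ℤ) = u * v * (s * u) := by ring
      rw [e] at h
      rcases hp'.dvd_or_dvd h with h | h
      · exact (hp'.dvd_or_dvd h).elim hpu hpv
      · exact (hp'.dvd_or_dvd h).elim (hsdvd s hs p hp) hpu
  have hcover : U ⊆ S₀.image (· + 1) ∪ (S₁ ∪ ((V 1 ∪ V (-1)) ∪ (W 1 ∪ W (-1)))) := by
    intro p hp
    obtain ⟨hpX, q, hpq⟩ := Finset.mem_filter.1 hp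
    have hpp := hpq.1
    have hqp := hpq.2.1
    obtain ⟨a, d, s, ha, hd, hs, hpe, hqe⟩ := hpq.exists_eq
    have hpX' := Finset.mem_Icc.1 hpX
    have had : 0 < a * d := Nat.mul_pos (by omega) (by omega)
    by_cases hsm : a * d ∈ (Y + 1).smoothNumbers
    · apply Finset.mem_union_left
      rw [Finset.mem_image]
      exact ⟨a * d, Finset.mem_filter.2 ⟨Finset.mem_Icc.2 ⟨had, by omega⟩, hsm⟩, hpe.symm⟩
    apply Finset.mem_union_right
    obtain ⟨e, P, he, hP, hYP, hcase⟩ := exists_large_prime_factor ha (by omega) hsm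
    have hyP : y < P := (Nat.floor_lt (Real.exp_pos _).le).1 hYP
    -- the number of prime factors of `p - 1` decides between the two cases
    have key : ∀ u v : ℕ, u ≠ 0 → v ≠ 0 → p = u * v * P + 1 → p ∉ S₁ →
        (ArithmeticFunction.cardFactors u + ArithmeticFunction.cardFactors v + 1 : ℝ) ≤ K := by
      intro u v hu hv hpuv hp1
      by_contra hlt
      apply hp1
      refine Finset.mem_filter.2 ⟨hpX, hpp, u * v, P, Nat.mul_ne_zero hu hv, hP, hyP, hpuv, ?_⟩
      rw [ArithmeticFunction.cardFactors_mul hu hv]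
      push_cast; linarith
    by_cases hp1 : p ∈ S₁
    · exact Finset.mem_union_left _ hp1
    apply Finset.mem_union_right
    have hq1 : (2 : ℤ) ≤ q := by exact_mod_cast hqp.two_le
    have hP2 : (2 : ℤ) ≤ P := by exact_mod_cast hP.two_le
    have hd2 : (2 : ℤ) ≤ d := by exact_mod_cast hd
    have has : 1 ≤ (a : ℤ) + s := by
      by_contra hlt
      have : ((a : ℤ) + s) * d ≤ 0 := mul_nonpos_of_nonpos_of_nonneg (by omega) (by omega)
      omega
    have he1 : (1 : ℤ) ≤ e := by omega
    rcases hcase with hdP | haP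
    · have hpuv : p = a * e * P + 1 := by rw [hpe, hdP]; ring
      have hmem : p ∈ V s := by
        refine Finset.mem_filter.2 ⟨hpX, hpp, a, e, P, q, ha, he,
          show (a : ℤ) + s ≠ 0 by omega, hP, hyP, hpuv, hqp,
          ?_, ?_, key a e ha he hpuv hp1⟩
        · have h3 : (d : ℤ) ≤ (a + s) * d := le_mul_of_one_le_left (by omega) has
          have h4 : P ≤ d := by rw [hdP]; exact Nat.le_mul_of_pos_left P (by omega)
          omega
        · rw [hqe, hdP]; push_cast; ring
      apply Finset.mem_union_left
      rcases hs with rfl | rfl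
      · exact Finset.mem_union_left _ hmem
      · exact Finset.mem_union_right _ hmem
    · have hpuv : p = d * e * P + 1 := by rw [hpe, haP]; ring
      have hmem : p ∈ W s := by
        refine Finset.mem_filter.2 ⟨hpX, hpp, d, e, P, q, by omega, he, ?_, hP, hyP, hpuv, hqp,
          ?_, ?_, key d e (by omega) he hpuv hp1⟩
        · show 1 + s * (d : ℤ) ≠ 0
          rcases hs with rfl | rfl <;> omega
        · have h3 : ((a : ℤ) + s) * 2 ≤ (a + s) * d := mul_le_mul_of_nonneg_left hd2 (by omega)
          have h4 : P ≤ a := by rw [haP]; exact Nat.le_mul_of_pos_left P (by omega)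
          rcases hs with rfl | rfl <;> omega
        · rw [hqe, haP]; push_cast; ring
      apply Finset.mem_union_right
      rcases hs with rfl | rfl
      · exact Finset.mem_union_left _ hmem
      · exact Finset.mem_union_right _ hmem
  have hS₀card : (S₀.card : ℝ) ≤ C₀ * x * (Real.exp (-(13 * L)) * l ^ 11) := by
    have h3 := h0 x y (by linarith) hy8
    have e : Real.log x / Real.log y = 13 * L := by
      rw [← hl, hlogy]; field_simp
    rw [e] at h3
    have h4 : Real.log y ≤ l := by
      rw [hlogy]; apply div_le_self hl0.le; linarith
    calc (S₀.card : ℝ) ≤ _ := h3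
      _ ≤ C₀ * x * Real.exp (-(13 * L)) * l ^ 11 := by gcongr
      _ = _ := by ring
  have hS₁card : (S₁.card : ℝ) ≤ C₁ * x * κ ^ (-K) * L ^ 6 / l ^ 2 * l ^ κ := by
    refine h1 K _ fun p hp => ?_
    obtain ⟨h3, h4, h5⟩ := Finset.mem_filter.1 hp
    exact ⟨h4, hxmem p h3, h5⟩
  have htotal : (U.card : ℝ) ≤ S₀.card + S₁.card +
      (((V 1).card + (V (-1)).card) + ((W 1).card + (W (-1)).card)) := by
    have h3 := Finset.card_le_card hcover
    have h4 := Finset.card_union_le (S₀.image (· + 1)) (S₁ ∪ ((V 1 ∪ V (-1)) ∪ (W 1 ∪ W (-1))))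
    have h5 := Finset.card_union_le S₁ ((V 1 ∪ V (-1)) ∪ (W 1 ∪ W (-1)))
    have h6 := Finset.card_union_le (V 1 ∪ V (-1)) (W 1 ∪ W (-1))
    have h7 := Finset.card_union_le (V 1) (V (-1))
    have h8 := Finset.card_union_le (W 1) (W (-1))
    have h9 : (S₀.image (· + 1)).card ≤ S₀.card := Finset.card_image_le
    have h10 : U.card ≤ S₀.card + S₁.card +
      (((V 1).card + (V (-1)).card) + ((W 1).card + (W (-1)).card)) := by omega
    exact_mod_cast h10
  rw [hcount]
  have hV1 := hVcard 1 (Or.inl rfl)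
  have hV2 := hVcard (-1) (Or.inr rfl)
  have hW1 := hWcard 1 (Or.inl rfl)
  have hW2 := hWcard (-1) (Or.inr rfl)
  set E₀ := Real.exp (-(13 * L)) * l ^ 11 with hE₀
  set E₁ := κ ^ (-K) * L ^ 6 / l ^ 2 * l ^ κ with hE₁
  set E₂ := (κ / 2) ^ (-K) * L ^ 9 / l ^ 3 * (l ^ (κ / 2)) ^ 2 with hE₂
  have e1 : C₁ * x * κ ^ (-K) * L ^ 6 / l ^ 2 * l ^ κ = C₁ * x * E₁ := by rw [hE₁]; ring
  have e2 : C₂ * x * (κ / 2) ^ (-K) * L ^ 9 / l ^ 3 * (l ^ (κ / 2)) ^ 2 = C₂ * x * E₂ := by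
    rw [hE₂]; ring
  rw [e1] at hS₁card
  rw [e2] at hV1 hV2 hW1 hW2
  have p0 : 0 ≤ E₀ := by positivity
  have p1 : 0 ≤ E₁ := by positivity
  have p2 : 0 ≤ E₂ := by positivity
  calc (U.card : ℝ) ≤ C₀ * x * E₀ + C₁ * x * E₁ + 4 * C₂ * x * E₂ := by linarith
    _ ≤ (C₀ + C₁ + 4 * C₂) * x * E₀ + (C₀ + C₁ + 4 * C₂) * x * E₁
          + (C₀ + C₁ + 4 * C₂) * x * E₂ := by
        gcongr <;> linarith
    _ = _ := by ring

/-- Chebyshev's lower bound for `π(x)`. -/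
theorem eventually_div_log_le_primeCounting : ∀ᶠ x : ℝ in Filter.atTop,
    x / (4 * Real.log x) ≤ (Nat.primeCounting ⌊x⌋₊ : ℝ) := by
  have h1 : ∀ᶠ x : ℝ in Filter.atTop, Real.log x ≤ 1 / 16 * x := by
    have := Real.isLittleO_log_id_atTop.bound (show (0 : ℝ) < 1 / 16 by norm_num)
    filter_upwards [this, Filter.eventually_ge_atTop 1] with x hx h1
    simpa [abs_of_nonneg (Real.log_nonneg h1), abs_of_nonneg (by linarith : 0 ≤ x)] using hx
  filter_upwards [h1, Filter.eventually_ge_atTop 16] with x h1 h2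
  have hl : 0 < Real.log x := Real.log_pos (by linarith)
  refine le_trans ?_ (Chebyshev.pi_ge' (by linarith))
  rw [← div_div]
  apply div_le_div_of_nonneg_right _ hl.le
  have h3 : Real.log (x + 2) ≤ 2 * Real.log x := by
    rw [← Real.log_rpow (by linarith)]
    apply Real.log_le_log (by linarith)
    norm_num; nlinarith
  have := Real.log_two_gt_d9
  nlinarith

theorem theorem1 :
    ∃ C : ℝ, ∀ᶠ x : ℝ in Filter.atTop,
      (symmetricPrimeCount x : ℝ) ≤
        (Nat.primeCounting ⌊x⌋₊ : ℝ) / (Real.log x) ^ symmetricEta *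
          (Real.log (Real.log x)) ^ C := by
  have hl2 : 0 < Real.log 2 := Real.log_pos (by norm_num)
  -- the threshold `κ log log x` for the number of prime factors that balances the two cases
  set κ : ℝ := 1 / Real.log 2 with hκ
  have hκ1 : 1 ≤ κ := by rw [hκ, one_le_div hl2]; linarith [Real.log_two_lt_d9]
  have hκ2 : κ < 2 := by rw [hκ, div_lt_iff₀ hl2]; linarith [Real.log_two_gt_d9]
  have hκ0 : 0 < κ := by linarith
  have hη : symmetricEta = κ * Real.log κ - κ + 1 := by
    rw [symmetricEta, hκ, one_div, Real.log_inv]; field_simp; ring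
  have hκlog : κ * Real.log 2 = 1 := by rw [hκ]; field_simp
  obtain ⟨C, hC, h⟩ := exists_symmetricPrimeCount_le hκ1 hκ2
  have hL : Filter.Tendsto (fun x : ℝ => Real.log (Real.log x)) Filter.atTop Filter.atTop :=
    Real.tendsto_log_atTop.comp Real.tendsto_log_atTop
  refine ⟨10, ?_⟩
  filter_upwards [h, eventually_div_log_le_primeCounting, Filter.eventually_gt_atTop 1,
    hL.eventually_ge_atTop (12 * C), hL.eventually_ge_atTop 1] with x h hπ hx1 hLC hL1
  have hl0 : 0 < Real.log x := Real.log_pos hx1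
  set l := Real.log x with hl
  set L := Real.log l with hLdef
  have hexp : ∀ n : ℕ, l ^ n = Real.exp (n * L) := fun n => by
    rw [Real.exp_nat_mul, Real.exp_log hl0]
  have hrexp : ∀ t : ℝ, l ^ t = Real.exp (t * L) := fun t => by
    rw [Real.rpow_def_of_pos hl0, mul_comm]
  have a0 : Real.exp (-(13 * L)) * l ^ 11 ≤ Real.exp (-((1 + symmetricEta) * L)) := by
    rw [hexp, ← Real.exp_add]
    apply Real.exp_le_exp.2
    have := symmetricEta_le_one
    push_cast; nlinarith
  have a1 : κ ^ (-(κ * L)) * L ^ 6 / l ^ 2 * l ^ κ =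
      L ^ 6 * Real.exp (-((1 + symmetricEta) * L)) := by
    rw [hexp, hrexp, Real.rpow_def_of_pos hκ0, div_eq_mul_inv, ← Real.exp_neg]
    have e : -((1 + symmetricEta) * L) = Real.log κ * -(κ * L) + -((2 : ℕ) * L) + κ * L := by
      rw [hη]; push_cast; ring
    rw [e, Real.exp_add, Real.exp_add]; ring
  have a2 : (κ / 2) ^ (-(κ * L)) * L ^ 9 / l ^ 3 * (l ^ (κ / 2)) ^ 2 =
      L ^ 9 * Real.exp (-((1 + symmetricEta) * L)) := by
    rw [hexp, hrexp, Real.rpow_def_of_pos (by positivity), div_eq_mul_inv, ← Real.exp_neg,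
      Real.log_div hκ0.ne' (by norm_num), ← Real.exp_nat_mul]
    have e : -((1 + symmetricEta) * L) = (Real.log κ - Real.log 2) * -(κ * L) + -((3 : ℕ) * L)
        + ((2 : ℕ) : ℝ) * (κ / 2 * L) := by
      rw [hη]; push_cast; linear_combination L * (-hκlog)
    rw [e, Real.exp_add, Real.exp_add]; ring
  rw [a1, a2] at h
  set E := Real.exp (-((1 + symmetricEta) * L)) with hE
  have hE0 : 0 < E := Real.exp_pos _
  have hx0 : 0 < x := by linarith
  have h9 : C * x * (Real.exp (-(13 * L)) * l ^ 11 + L ^ 6 * E + L ^ 9 * E) ≤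
      C * x * (3 * L ^ 9 * E) := by
    have b1 : 1 ≤ L ^ 9 := one_le_pow₀ hL1
    have b2 : L ^ 6 ≤ L ^ 9 := pow_le_pow_right₀ hL1 (by norm_num)
    gcongr
    have b3 := mul_le_mul_of_nonneg_right b1 hE0.le
    have b4 := mul_le_mul_of_nonneg_right b2 hE0.le
    linarith
  calc (symmetricPrimeCount x : ℝ) ≤ _ := h
    _ ≤ C * x * (3 * L ^ 9 * E) := h9
    _ = (12 * C) * (x * L ^ 9 * E / 4) := by ring
    _ ≤ L * (x * L ^ 9 * E / 4) := by gcongr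
    _ = x / (4 * l) / l ^ symmetricEta * L ^ 10 := by
        have e : E = (l * l ^ symmetricEta)⁻¹ := by
          rw [hrexp, hE, Real.exp_neg, add_mul, one_mul, Real.exp_add, Real.exp_log hl0]
        rw [e, mul_inv]
        ring
    _ ≤ (Nat.primeCounting ⌊x⌋₊ : ℝ) / l ^ symmetricEta * L ^ 10 := by gcongr
    _ = _ := by norm_cast
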